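/- Let $K$ be a field, $A$ a finite-dimensional $K$-algebra and $P$ a finite poset. A \emph{$P$-multiplicative system} $R$ over $A$ is a family of $K$-subspaces $R_{i,j}\subseteq A$ ($i\le j$ in $P$) with $R_{i,j}R_{j,l}\subseteq R_{i,l}$ such that each $R_i=R_{i,i}$ has a unit $1_i$ with $1_ir=r=r1_j$ for all $r\in R_{i,j}$. Its \emph{incidence algebra} $\Lambda(R)$ consists of the $P\times P$ matrices with $(i,j)$ entry in $R_{i,j}$ for $i\le j$ and zero otherwise, with the matrix product and unit $\sum_i e_i$, where $e_i$ is the matrix with the single entry $1_i$ at $(i,i)$. If $P$ has a largest element $\mathfrak m$, the system $R$ is \emph{admissible} if every $R_i$ is a division ring and for every $j<\mathfrak m$ and $0\ne x\in R_{i,j}$ there are $l\ne j$ and $y\in R_{j,l}$ with $xy\neq 0$. A \emph{representation} of $(P,A,R)$ is a right $A$-module $L$ with $K$-subspaces $L_i$ ($i\in P$) such that $L_iR_{i,j}\subseteq L_j$ for $i\le j$ and $a1_i=a$ for $a\in L_i$; morphisms are the $A$-linear maps $h$ with $h(L_i)\subseteq M_i$; the category is $\mathrm{Rep}(P,A,R)$.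 Let $T$ be a $P$-multiplicative system such that every $T_i$ is a (unital) subalgebra of $A$. Let $P^{\mathfrak m}$ be $P$ with a new largest element $\mathfrak m$, and extend $T$ to $T^{\mathfrak m}$ by $T_{i,\mathfrak m}=A$ for all $i\in P^{\mathfrak m}$. Suppose that $(P,A,T)$ is \emph{extendable}: there are idempotents $\varepsilon_i\in T^{\mathfrak m}_{i}$ ($i\in P^{\mathfrak m}$) such that $A$ is semisimple with $\varepsilon_{\mathfrak m}A$ as its only simple right module up to isomorphism, the system $R_{i,j}=\varepsilon_iT^{\mathfrak m}_{i,j}\varepsilon_j$ (with unit $\varepsilon_i$ in $R_i$) is admissible, and $\Lambda(R)$ is Morita equivalent to $\Lambda(T^{\mathfrak m})$. Now add also a smallest element $0$ to $P^{\mathfrak m}$, put $T_{0,i}=A$ for all $i$ and $\varepsilon_0=\varepsilon_{\mathfrak m}$, let $\underline R_{i,j}=\varepsilon_iT_{i,j}\varepsilon_j$ be the resulting system on the enlarged poset, and let $\Lambda=\Lambda(\underline R)$. Let $\mathcal U$ be the full subcategory of the category of all right $\Lambda$-modules formed by the modules with projective socle and without a direct summand isomorphic to $e_0\Lambda$, and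 let $\mathcal V$ be the full subcategory formed by the modules $M$ whose top $M/\mathrm{rad}\,M$ is injective and which have no direct summand isomorphic to $e_0\Lambda$. Then: (a) Every $M\in\mathcal U$ has an injective envelope of the form $i_M:M\to(e_0\Lambda)^{(\nu(M))}$, a direct sum of copies of $e_0\Lambda$ indexed by a set $\nu(M)$. (b) For every choice of such injective envelopes $i_M$ ($M\in\mathcal U$), every $f:M\to N$ in $\mathcal U$ has a unique extension $\hat f:(e_0\Lambda)^{(\nu(M))}\to(e_0\Lambda)^{(\nu(N))}$ with $\hat f i_M=i_Nf$, and there is a functor $F:\mathcal U\to\mathcal V$ with $F(M)=\mathrm{Coker}\,i_M$ (up to isomorphism) and with $F(f)$ induced by $\hat f$ on cokernels. This $F$ is an equivalence of categories, and it is exact: if $0\to M_1\to M_2\to M_3\to0$ is a sequence in $\mathcal U$ that is exact as a sequence of $\Lambda$-modules, then so is $0\to F(M_1)\to F(M_2)\to F(M_3)\to 0$. (c) The categories $\mathrm{Rep}(P,A,T)$ and $\mathcal U$ are equivalent. -/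

import Mathlib

open CategoryTheory

universe u

/-! ### Multiplicative systems and incidence algebras -/

/-- A `P`-multiplicative system over the `K`-algebra `A`: subspaces `R i j` of `A` for `i ≤ j`
(for `i ≰ j` the value is `⊥` by convention), with `R i j * R j l ⊆ R i l`, such that every `R i i`
has a unit `one i` which acts as an identity on the left of `R i j` and on the right of `R j i`. -/
structure MultSystem (K A P : Type u) [Field K] [Ring A] [Algebra K A] [PartialOrder P] where
  space : P → P → Submodule K A
  space_eq_bot : ∀ i j, ¬ i ≤ j → space i j = ⊥
  mul_mem : ∀ i j l, i ≤ j → j ≤ l → ∀ x ∈ space i j, ∀ y ∈ space j l, x * y ∈ space i l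
  one : P → A
  one_mem : ∀ i, one i ∈ space i i
  one_mul : ∀ i j, i ≤ j → ∀ x ∈ space i j, one i * x = x
  mul_one : ∀ i j, i ≤ j → ∀ x ∈ space i j, x * one j = x

namespace MultSystem

section Basic

variable {K A P : Type u} [Field K] [Ring A] [Algebra K A] [PartialOrder P]

theorem mul_mem' (R : MultSystem K A P) (i j l : P) {x y : A} (hx : x ∈ R.space i j)
    (hy : y ∈ R.space j l) : x * y ∈ R.space i l := by
  by_cases hij : i ≤ j
  · by_cases hjl : j ≤ l
    · exact R.mul_mem i j l hij hjl x hx y hy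
    · rw [R.space_eq_bot j l hjl, Submodule.mem_bot] at hy
      simp [hy]
  · rw [R.space_eq_bot i j hij, Submodule.mem_bot] at hx
    simp [hx]

theorem one_mul' (R : MultSystem K A P) (i j : P) {x : A} (hx : x ∈ R.space i j) :
    R.one i * x = x := by
  by_cases hij : i ≤ j
  · exact R.one_mul i j hij x hx
  · rw [R.space_eq_bot i j hij, Submodule.mem_bot] at hx
    simp [hx]

theorem mul_one' (R : MultSystem K A P) (i j : P) {x : A} (hx : x ∈ R.space i j) :
    x * R.one j = x := by
  by_cases hij : i ≤ j
  · exact R.mul_one i j hij x hx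
  · rw [R.space_eq_bot i j hij, Submodule.mem_bot] at hx
    simp [hx]

/-- The matrices `(a i j)` with entries `a i j ∈ R i j` (hence `a i j = 0` for `i ≰ j`). -/
def matrices (R : MultSystem K A P) : Submodule K (Matrix P P A) where
  carrier := {a | ∀ i j, a i j ∈ R.space i j}
  add_mem' ha hb i j := (R.space i j).add_mem (ha i j) (hb i j)
  zero_mem' i j := (R.space i j).zero_mem
  smul_mem' c _ ha i j := (R.space i j).smul_mem c (ha i j)

/-- The incidence algebra `Λ(R) = ⨁_{i ≤ j} e_{ij} R i j`. -/
def IncAlg (R : MultSystem K A P) : Type u := R.matrices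

namespace IncAlg

variable (R : MultSystem K A P)

instance : AddCommGroup R.IncAlg := inferInstanceAs (AddCommGroup R.matrices)

instance : Module K R.IncAlg := inferInstanceAs (Module K R.matrices)

/-- The underlying matrix of an element of the incidence algebra. -/
def val {R : MultSystem K A P} (a : R.IncAlg) : Matrix P P A := a.1

theorem val_mem {R : MultSystem K A P} (a : R.IncAlg) (i j : P) : a.val i j ∈ R.space i j :=
  a.2 i j

theorem ext' {R : MultSystem K A P} {a b : R.IncAlg} (h : ∀ i j, a.val i j = b.val i j) :
    a = b :=
  Subtype.ext (Matrix.ext h)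

open Classical in
/-- The element `e_i = e_{ii} 1_i` of the incidence algebra. -/
noncomputable def idem (i : P) : R.IncAlg :=
  ⟨fun k l => if k = i ∧ l = i then R.one i else 0, fun k l => by
    by_cases h : k = i ∧ l = i
    · simpa [h] using R.one_mem i
    · simp [h]⟩

open Classical in
/-- The unit is the diagonal matrix with entries `1_i`; it need not be the unit of the full
matrix ring over `A`. -/
noncomputable instance : One R.IncAlg :=
  ⟨⟨fun k l => if k = l then R.one k else 0, fun k l => by
    by_cases h : k = l
    · subst h; simpa using R.one_mem k
    · simp [h]⟩⟩

open Classical in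
theorem val_one (i j : P) : (1 : R.IncAlg).val i j = if i = j then R.one i else 0 := rfl

variable [Fintype P]

/-- The product is the product of matrices. -/
instance : Mul R.IncAlg :=
  ⟨fun a b => ⟨a.val * b.val, fun i l => by
    rw [Matrix.mul_apply]
    exact Submodule.sum_mem _ fun j _ => R.mul_mem' i j l (a.val_mem i j) (b.val_mem j l)⟩⟩

theorem val_mul (a b : R.IncAlg) : (a * b).val = a.val * b.val := rfl

noncomputable instance : Ring R.IncAlg where
  __ := (inferInstance : AddCommGroup R.IncAlg)
  mul := (· * ·)
  one := 1
  left_distrib a b c := Subtype.ext (Matrix.mul_add a.val b.val c.val)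
  right_distrib a b c := Subtype.ext (Matrix.add_mul a.val b.val c.val)
  zero_mul a := Subtype.ext (Matrix.zero_mul a.val)
  mul_zero a := Subtype.ext (Matrix.mul_zero a.val)
  mul_assoc a b c := Subtype.ext (Matrix.mul_assoc a.val b.val c.val)
  one_mul a := ext' fun i j => by
    classical
    rw [val_mul, Matrix.mul_apply]
    simp only [val_one, ite_mul, zero_mul, Finset.sum_ite_eq, Finset.mem_univ, if_true]
    exact R.one_mul' i j (a.val_mem i j)
  mul_one a := ext' fun i j => by
    classical
    rw [val_mul, Matrix.mul_apply]
    simp only [val_one, mul_ite, mul_zero, Finset.sum_ite_eq', Finset.mem_univ, if_true]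
    exact R.mul_one' i j (a.val_mem i j)

noncomputable instance : Algebra K R.IncAlg :=
  Algebra.ofModule
    (fun c a b => Subtype.ext (Matrix.smul_mul c a.val b.val))
    (fun c a b => Subtype.ext (Matrix.mul_smul a.val c b.val))

end IncAlg

/-- All `T i i` are (unital) subalgebras of `A`; closure under products holds in any system. -/
def IsUnital (T : MultSystem K A P) : Prop := ∀ i, (1 : A) ∈ T.space i i

theorem IsUnital.one_eq {T : MultSystem K A P} (hT : T.IsUnital) (i : P) : T.one i = 1 := by
  have h := T.one_mul i i le_rfl 1 (hT i)
  rwa [_root_.mul_one] at h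

/-- Adding a maximal point `⊤` to the poset, with `T i ⊤ = A` for all `i`. -/
def extendTop (T : MultSystem K A P) (hT : T.IsUnital) : MultSystem K A (WithTop P) where
  space i j := match i, j with
    | (a : P), (b : P) => T.space a b
    | _, ⊤ => ⊤
    | ⊤, (_ : P) => ⊥
  space_eq_bot i j h := by
    induction i using WithTop.recTopCoe with
    | top =>
      induction j using WithTop.recTopCoe with
      | top => exact absurd le_rfl h
      | coe b => rfl
    | coe a =>
      induction j using WithTop.recTopCoe with
      | top => exact absurd le_top h
      | coe b => exact T.space_eq_bot a b fun h' => h (WithTop.coe_le_coe.2 h')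
  mul_mem i j l hij hjl x hx y hy := by
    induction l using WithTop.recTopCoe with
    | top => cases i <;> trivial
    | coe c =>
      induction j using WithTop.recTopCoe with
      | top => exact absurd hjl (WithTop.not_top_le_coe c)
      | coe b =>
        induction i using WithTop.recTopCoe with
        | top => exact absurd hij (WithTop.not_top_le_coe b)
        | coe a => exact T.mul_mem' a b c hx hy
  one _ := 1
  one_mem i := by
    induction i using WithTop.recTopCoe with
    | top => trivial
    | coe a => exact hT a
  one_mul _ _ _ x _ := _root_.one_mul x
  mul_one _ _ _ x _ := _root_.mul_one x

/-- Adding a minimal point `⊥` to the poset, with `T ⊥ i = A` for all `i`. -/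
def extendBot (T : MultSystem K A P) (hT : T.IsUnital) : MultSystem K A (WithBot P) where
  space i j := match i, j with
    | (a : P), (b : P) => T.space a b
    | ⊥, _ => ⊤
    | (_ : P), ⊥ => ⊥
  space_eq_bot i j h := by
    induction i using WithBot.recBotCoe with
    | bot => exact absurd bot_le h
    | coe a =>
      induction j using WithBot.recBotCoe with
      | bot => rfl
      | coe b => exact T.space_eq_bot a b fun h' => h (WithBot.coe_le_coe.2 h')
  mul_mem i j l hij hjl x hx y hy := by
    induction i using WithBot.recBotCoe with
    | bot => cases l <;> trivial
    | coe a =>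
      induction j using WithBot.recBotCoe with
      | bot => exact absurd hij (WithBot.not_coe_le_bot a)
      | coe b =>
        induction l using WithBot.recBotCoe with
        | bot => exact absurd hjl (WithBot.not_coe_le_bot b)
        | coe c => exact T.mul_mem' a b c hx hy
  one _ := 1
  one_mem i := by
    induction i using WithBot.recBotCoe with
    | bot => trivial
    | coe a => exact hT a
  one_mul _ _ _ x _ := _root_.one_mul x
  mul_one _ _ _ x _ := _root_.mul_one x

theorem extendTop_isUnital (T : MultSystem K A P) (hT : T.IsUnital) :
    (T.extendTop hT).IsUnital := (T.extendTop hT).one_mem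

/-- A family of idempotents `ε i ∈ T i i`. -/
structure IsIdemFamily (T : MultSystem K A P) (ε : P → A) : Prop where
  mem : ∀ i, ε i ∈ T.space i i
  idem : ∀ i, ε i * ε i = ε i

/-- The system `R i j = ε_i (T i j) ε_j` cut out by idempotents `ε_i ∈ T i i`; the unit of `R i i`
is `ε_i`. -/
def corner (T : MultSystem K A P) (ε : P → A) (hε : T.IsIdemFamily ε) : MultSystem K A P where
  space i j := (T.space i j).map (LinearMap.mulLeft K (ε i) ∘ₗ LinearMap.mulRight K (ε j))
  space_eq_bot i j h := by rw [T.space_eq_bot i j h, Submodule.map_bot]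
  mul_mem i j l _ _ := by
    rintro _ ⟨x, hx, rfl⟩ _ ⟨y, hy, rfl⟩
    refine ⟨x * ε j * y, T.mul_mem' i j l (T.mul_mem' i j j hx (hε.mem j)) hy, ?_⟩
    have h : ε j * (ε j * (y * ε l)) = ε j * (y * ε l) := by rw [← mul_assoc, hε.idem]
    simp [mul_assoc, h]
  one := ε
  one_mem i := ⟨ε i, hε.mem i, by simp [hε.idem]⟩
  one_mul i j _ := by
    rintro _ ⟨x, _, rfl⟩
    simp [← mul_assoc, hε.idem]
  mul_one i j _ := by
    rintro _ ⟨x, _, rfl⟩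
    simp [mul_assoc, hε.idem]

/-- Admissible systems on a poset with largest element `⊤`: each `R i i` is a division ring (with
unit `1_i`), and for `j < ⊤` and `0 ≠ x ∈ R i j` there are `l ≠ j` and `y ∈ R j l` with
`x y ≠ 0`. -/
structure IsAdmissible [OrderTop P] (R : MultSystem K A P) : Prop where
  one_ne_zero : ∀ i, R.one i ≠ 0
  exists_inv : ∀ i, ∀ x ∈ R.space i i, x ≠ 0 →
    ∃ y ∈ R.space i i, x * y = R.one i ∧ y * x = R.one i
  exists_mul_ne_zero : ∀ i j, j < ⊤ → ∀ x ∈ R.space i j, x ≠ 0 →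
    ∃ l, l ≠ j ∧ ∃ y ∈ R.space j l, x * y ≠ 0

end Basic

end MultSystem

/-! ### Modules -/

/-- The right ideal `e B` of a ring `B`. Right `B`-modules are modules over `Bᵐᵒᵖ`. -/
abbrev rightIdeal {B : Type u} [Ring B] (e : B) : Submodule Bᵐᵒᵖ B := Submodule.span Bᵐᵒᵖ {e}

section Modules

variable (B : Type u) [Ring B] (M : Type u) [AddCommGroup M] [Module B M]

/-- The socle: the sum of all simple submodules. -/
def moduleSocle : Submodule B M := sSup {N : Submodule B M | IsSimpleModule B N}

/-- `M` is socle-projective. -/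
def IsSocleProjective : Prop := Module.Projective B (moduleSocle B M)

/-- The top `M / rad M` is injective; `rad M` is the intersection of the maximal submodules. -/
def HasInjectiveTop : Prop := Module.Injective B (M ⧸ Module.jacobson B M)

/-- `M` has a direct summand isomorphic to `Q`. -/
def HasSummand (Q : Type u) [AddCommGroup Q] [Module B Q] : Prop :=
  ∃ N N' : Submodule B M, IsCompl N N' ∧ Nonempty (N ≃ₗ[B] Q)

/-- An injective envelope `M → Q^(ν)` of `M` whose target is a direct sum of copies of `Q`. -/
structure SumEnvelope (Q : Type u) [AddCommGroup Q] [Module B Q] where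
  ν : Type u
  map : M →ₗ[B] (ν →₀ Q)
  target_injective : Module.Injective B (ν →₀ Q)
  map_injective : Function.Injective map
  essential : ∀ N : Submodule B (ν →₀ Q), N ⊓ LinearMap.range map = ⊥ → N = ⊥

end Modules

section Categories

variable (B : Type u) [Ring B] (Q : Type u) [AddCommGroup Q] [Module B Q]

/-- The full subcategory of socle-projective modules without direct summand `Q`. -/
abbrev CatU := ObjectProperty.FullSubcategory
  (fun M : ModuleCat.{u} B => IsSocleProjective B M ∧ ¬ HasSummand B M Q)

/-- The full subcategory of modules with injective top and without direct summand `Q`. -/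
abbrev CatV := ObjectProperty.FullSubcategory
  (fun M : ModuleCat.{u} B => HasInjectiveTop B M ∧ ¬ HasSummand B M Q)

variable {B}

/-- The linear map underlying a morphism of a full subcategory of a module category. -/
abbrev fullHom {p : ObjectProperty (ModuleCat.{u} B)} {M N : p.FullSubcategory} (f : M ⟶ N) :
    M.obj →ₗ[B] N.obj := f.hom.hom

/-- A functor between full subcategories of a module category is exact if it preserves the
sequences `0 → M₁ → M₂ → M₃ → 0` which are exact sequences of modules. -/
def IsExactFunctor {p q : ObjectProperty (ModuleCat.{u} B)}
    (F : p.FullSubcategory ⥤ q.FullSubcategory) : Prop :=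
  ∀ ⦃M₁ M₂ M₃ : p.FullSubcategory⦄ (f : M₁ ⟶ M₂) (g : M₂ ⟶ M₃),
    Function.Injective (fullHom f) → Function.Exact (fullHom f) (fullHom g) →
      Function.Surjective (fullHom g) →
    Function.Injective (fullHom (F.map f)) ∧
      Function.Exact (fullHom (F.map f)) (fullHom (F.map g)) ∧
      Function.Surjective (fullHom (F.map g))

variable {Q}

/-- `F` is given by the cokernels of the chosen injective envelopes `i_M : M → Q^(ν M)`: there are
exact sequences `0 → M → Q^(ν M) → F M → 0`, every `f : M → N` has exactly one extension
`f' : Q^(ν M) → Q^(ν N)`, and `F f` is the map induced by `f'` on the cokernels. -/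
def IsCokernelFunctor {p q : ObjectProperty (ModuleCat.{u} B)}
    (env : ∀ M : p.FullSubcategory, SumEnvelope B M.obj Q)
    (F : p.FullSubcategory ⥤ q.FullSubcategory) : Prop :=
  ∃ j : ∀ M : p.FullSubcategory, ((env M).ν →₀ Q) →ₗ[B] (F.obj M).obj,
    (∀ M, Function.Surjective (j M) ∧ Function.Exact (env M).map (j M)) ∧
    ∀ ⦃M N : p.FullSubcategory⦄ (f : M ⟶ N),
      (∃! f' : ((env M).ν →₀ Q) →ₗ[B] ((env N).ν →₀ Q),
        f' ∘ₗ (env M).map = (env N).map ∘ₗ fullHom f) ∧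
      ∀ f' : ((env M).ν →₀ Q) →ₗ[B] ((env N).ν →₀ Q),
        f' ∘ₗ (env M).map = (env N).map ∘ₗ fullHom f →
          fullHom (F.map f) ∘ₗ j M = j N ∘ₗ f'

end Categories

namespace MultSystem

variable {K A P : Type u} [Field K] [Ring A] [Algebra K A] [PartialOrder P]

/-! ### Representations -/

/-- A representation `(L, L_i : i ∈ P)` of the algebraically equipped poset `(P, A, R)`: a right
`A`-module `L` with `K`-subspaces `L_i` such that `L_i R i j ⊆ L_j` and `a 1_i = a` on `L_i`. -/
structure Rep (R : MultSystem K A P) where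
  L : Type u
  [addCommGroup : AddCommGroup L]
  [module : Module Aᵐᵒᵖ L]
  sub : P → AddSubgroup L
  smul_mem : ∀ i (c : K), ∀ x ∈ sub i, MulOpposite.op (algebraMap K A c) • x ∈ sub i
  mul_mem : ∀ i j, i ≤ j → ∀ x ∈ sub i, ∀ r ∈ R.space i j, MulOpposite.op r • x ∈ sub j
  mul_one : ∀ i, ∀ x ∈ sub i, MulOpposite.op (R.one i) • x = x

attribute [instance] Rep.addCommGroup Rep.module

/-- A morphism of representations is an `A`-linear map `h : L → M` with `h (L_i) ⊆ M_i`. -/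
@[ext]
structure Rep.Hom {R : MultSystem K A P} (X Y : R.Rep) where
  hom : X.L →ₗ[Aᵐᵒᵖ] Y.L
  map_mem : ∀ i, ∀ x ∈ X.sub i, hom x ∈ Y.sub i

instance (R : MultSystem K A P) : Category R.Rep where
  Hom := Rep.Hom
  id X := ⟨LinearMap.id, fun _ _ hx => hx⟩
  comp f g := ⟨g.hom ∘ₗ f.hom, fun i x hx => g.map_mem i _ (f.map_mem i x hx)⟩

/-! ### Extendable posets -/

variable [Fintype P]

/-- `(P, A, T)` is extendable, with the admissible system `R i j = ε_i (T i j) ε_j` on `P` with a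
maximal point `⊤` added. -/
structure IsExtendable (T : MultSystem K A P) (ε : WithTop P → A) : Prop where
  semisimple : IsSemisimpleRing A
  simple : IsSimpleModule Aᵐᵒᵖ (rightIdeal (ε ⊤))
  simple_unique : ∀ (N : Type u) [AddCommGroup N] [Module Aᵐᵒᵖ N], IsSimpleModule Aᵐᵒᵖ N →
    Nonempty (N ≃ₗ[Aᵐᵒᵖ] rightIdeal (ε ⊤))
  unital : T.IsUnital
  idemFamily : (T.extendTop unital).IsIdemFamily ε
  admissible : ((T.extendTop unital).corner ε idemFamily).IsAdmissible
  morita : IsMoritaEquivalent K ((T.extendTop unital).corner ε idemFamily).IncAlg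
    (T.extendTop unital).IncAlg

namespace IsExtendable

variable {T : MultSystem K A P} {ε : WithTop P → A} (h : T.IsExtendable ε)

/-- The idempotents `ε_i` together with `ε_0 = ε_𝔪` at the new minimal point. -/
def botIdem (ε : WithTop P → A) : WithBot (WithTop P) → A :=
  WithBot.recBotCoe (ε ⊤) ε

theorem botIdem_isIdemFamily (h : T.IsExtendable ε) :
    ((T.extendTop h.unital).extendBot (T.extendTop_isUnital h.unital)).IsIdemFamily
      (botIdem ε) where
  mem i := by
    induction i using WithBot.recBotCoe with
    | bot => trivial
    | coe a => exact h.idemFamily.mem a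
  idem i := by
    induction i using WithBot.recBotCoe with
    | bot => exact h.idemFamily.idem ⊤
    | coe a => exact h.idemFamily.idem a

/-- The system `R i j = ε_i (T i j) ε_j` on the poset `P` with a maximal point `𝔪` and a minimal
point `0` added, where `T i 𝔪 = A = T 0 i` and `ε_0 = ε_𝔪`. -/
def system (h : T.IsExtendable ε) : MultSystem K A (WithBot (WithTop P)) :=
  ((T.extendTop h.unital).extendBot (T.extendTop_isUnital h.unital)).corner (botIdem ε)
    h.botIdem_isIdemFamily

/-- The algebra `Λ`. -/
abbrev Alg (h : T.IsExtendable ε) : Type u := h.system.IncAlg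

/-- The right `Λ`-module `e_0 Λ`. -/
noncomputable abbrev E₀ (h : T.IsExtendable ε) : Submodule h.Algᵐᵒᵖ h.Alg :=
  rightIdeal (IncAlg.idem h.system ⊥)

end IsExtendable

end MultSystem

/-! Right `Λ`-modules are treated as left modules over `B = Λᵐᵒᵖ` with the dual order on the points,
so `𝔪` becomes the least index `s` and `0` the greatest index `o`. The corners `e_i Λ e_i` are
division rings. Hence a simple module is determined by the one `e_i` acting on it as identity, and
every module on which some `e_i` acts as identity is semisimple. Write `Q = e_0 Λ`.

The idempotent `ε_𝔪` is full in `A`: `∑ a_k b_k = 1` with `a_k ∈ A ε_𝔪` and `b_k ∈ ε_𝔪 A`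
(`nonempty_fullIdempotent`). So every nonzero element of `Λ` can be multiplied into a nonzero
element of the column at `𝔪`, and every map from `(e s) Y` to `Q^(ν)` extends to `Y`
(`exists_linearMap_extending`). Thus `Q^(ν)` is both injective and projective.

These facts, packaged in `SocleFrame`, make the two subcategories dual to each other. A module lies
in `U` iff it is detected by `e s` and killed by `e o` (`mem_U_iff`), and in `V` iff it is generated
by its `e o`-part and killed by `e s` (`mem_V_iff`). For `M` in `U` the image of `i_M` contains `(e
s) Q^(ν)`, so the cokernel lies in `V`; a module in `V` is covered by some `Q^(ν)` with kernel
killed by `e o`, so the kernel lies in `U`. Extensions to envelopes are unique because `Q^(ν)` is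
detected by `e s`; lifts of maps of cokernels are unique because `Q^(ν)` is generated by its `e
o`-part while the image of `i_N` is killed by `e o`. Exactness is a diagram chase once the extended
maps form a split exact sequence.

For (c), a representation goes to the rows with entries in `0`, `L_i ε_i` and `L ε_𝔪`. Fullness of
`ε_𝔪` recovers `L` from `L ε_𝔪`. Recovering `L_i` from `L_i ε_i` needs `ε_i` to be full in `T_i`,
which comes from Morita equivalence by counting simple modules (`one_mem_span_of_equivalence`).
Conversely, a module of `U` is embedded in its envelope `Q^(ν)` and represented on `L = (ε_𝔪 A)^(ν)`
by conductor subspaces. -/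

/-! ### Simple and semisimple modules over a ring with triangular idempotents. -/

/-- Complete orthogonal idempotents `e i` of `B` with `e i B e j = 0` for `i ≰ j` such that the
nonzero elements of `e i B e i` have left inverses. -/
structure TriangularIdempotents {B ι : Type*} [Ring B] [Fintype ι] [PartialOrder ι] (e : ι → B) :
    Prop extends CompleteOrthogonalIdempotents e where
  le_of_ne_zero : ∀ i j b, e i * b * e j ≠ 0 → i ≤ j
  exists_left_inv : ∀ i b, e i * b * e i ≠ 0 → ∃ c, c * (e i * b * e i) = e i

/-- The element `e` acts as the identity on `X`. -/
def ActsAsOne {B : Type*} [Ring B] (e : B) (X : Type*) [AddCommGroup X] [Module B X] : Prop :=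
  ∀ x : X, e • x = x

namespace TriangularIdempotents

variable {B ι : Type*} [Ring B] [Fintype ι] [PartialOrder ι] {e : ι → B}

theorem mul_self (he : TriangularIdempotents e) (i : ι) : e i * e i = e i := he.idem i

theorem eq_zero_of_not_le (he : TriangularIdempotents e) {i j : ι} (h : ¬ i ≤ j) (b : B) :
    e i * b * e j = 0 :=
  not_not.1 fun h' => h (he.le_of_ne_zero i j b h')

section Module

variable {X : Type*} [AddCommGroup X] [Module B X]

theorem sum_smul (he : TriangularIdempotents e) (x : X) : ∑ i, e i • x = x := by
  rw [← Finset.sum_smul, he.complete, one_smul]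

theorem exists_smul_ne_zero (he : TriangularIdempotents e) {x : X} (hx : x ≠ 0) :
    ∃ i, e i • x ≠ 0 := by
  by_contra! h
  exact hx (by rw [← he.sum_smul x, Finset.sum_eq_zero fun i _ => h i])

/-- Any nonzero vector of a simple module generates every other one. If `e i • x` and `e k • y` are
both nonzero, then `e k B e i` and `e i B e k` are nonzero and antisymmetry forces `k = i`; so the
remaining idempotents act by zero. -/
theorem actsAsOne_of_isSimpleModule (he : TriangularIdempotents e) [IsSimpleModule B X] {i : ι}
    {x : X} (hx : e i • x ≠ 0) : ActsAsOne (e i) X := by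
  have key : ∀ k, k ≠ i → ∀ y : X, e k • y = 0 := by
    intro k hk y
    by_contra hy
    obtain ⟨a, ha⟩ := IsSimpleModule.toSpanSingleton_surjective B hx (e k • y)
    obtain ⟨c, hc⟩ := IsSimpleModule.toSpanSingleton_surjective B hy (e i • x)
    simp only [LinearMap.toSpanSingleton_apply, smul_smul] at ha hc
    refine hk (le_antisymm (he.le_of_ne_zero k i a fun h => hy ?_)
      (he.le_of_ne_zero i k c fun h => hx ?_))
    · rw [← he.mul_self, mul_smul, ← ha, smul_smul, ← mul_assoc, h, zero_smul]
    · rw [← he.mul_self, mul_smul, ← hc, smul_smul, ← mul_assoc, h, zero_smul]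
  intro y
  conv_rhs => rw [← he.sum_smul y]
  exact (Finset.sum_eq_single i (fun k _ hk => key k hk y) (by simp)).symm

theorem exists_actsAsOne (he : TriangularIdempotents e) [IsSimpleModule B X] :
    ∃ i, ActsAsOne (e i) X := by
  have := IsSimpleModule.nontrivial B X
  obtain ⟨x, hx⟩ := exists_ne (0 : X)
  obtain ⟨i, hi⟩ := he.exists_smul_ne_zero hx
  exact ⟨i, he.actsAsOne_of_isSimpleModule hi⟩

end Module

end TriangularIdempotents

namespace ActsAsOne

variable {B X Y : Type*} [Ring B] {e : B} [AddCommGroup X] [Module B X] [AddCommGroup Y]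
  [Module B Y]

theorem smul_eq (h : ActsAsOne e X) (b : B) (x : X) : b • x = (e * b * e) • x := by
  rw [mul_smul, mul_smul, h, h]

theorem submodule (h : ActsAsOne e X) (N : Submodule B X) : ActsAsOne e N :=
  fun x => Subtype.ext (h x)

theorem of_surjective (h : ActsAsOne e X) (f : X →ₗ[B] Y) (hf : Function.Surjective f) :
    ActsAsOne e Y := fun y => by
  obtain ⟨x, rfl⟩ := hf y
  rw [← map_smul, h]

end ActsAsOne

namespace TriangularIdempotents

variable {B ι : Type*} [Ring B] [Fintype ι] [PartialOrder ι] {e : ι → B}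
variable {X Y : Type*} [AddCommGroup X] [Module B X] [AddCommGroup Y] [Module B Y]

/-- Such an `X` is in effect a vector space over the division ring `e i B e i`. The annihilator of a
nonzero vector therefore depends on `i` only. -/
theorem smul_eq_zero_iff (he : TriangularIdempotents e) {i : ι} (h : ActsAsOne (e i) X) {x : X}
    (hx : x ≠ 0) (b : B) : b • x = 0 ↔ e i * b * e i = 0 := by
  rw [h.smul_eq]
  refine ⟨fun h0 => ?_, fun h0 => by rw [h0, zero_smul]⟩
  by_contra h1
  obtain ⟨c, hc⟩ := he.exists_left_inv i b h1
  exact hx (by rw [← h x, ← hc, mul_smul, h0, smul_zero])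

theorem exists_smul_smul_eq (he : TriangularIdempotents e) {i : ι} (h : ActsAsOne (e i) X) {x : X}
    {b : B} (hb : b • x ≠ 0) : ∃ c : B, c • b • x = x := by
  rw [h.smul_eq] at hb ⊢
  obtain ⟨c, hc⟩ := he.exists_left_inv i b fun h0 => hb (by rw [h0, zero_smul])
  exact ⟨c, by rw [smul_smul, hc, h]⟩

theorem isSimpleModule_span (he : TriangularIdempotents e) {i : ι} (h : ActsAsOne (e i) X) {x : X}
    (hx : x ≠ 0) : IsSimpleModule B (Submodule.span B {x}) := by
  rw [isSimpleModule_iff_isAtom]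
  refine ⟨by simpa using hx, fun N hN => ?_⟩
  by_contra hN0
  obtain ⟨y, hyN, hy⟩ := (Submodule.ne_bot_iff N).1 hN0
  obtain ⟨b, rfl⟩ := Submodule.mem_span_singleton.1 (hN.le hyN)
  obtain ⟨c, hc⟩ := he.exists_smul_smul_eq h hy
  refine hN.not_ge ((Submodule.span_singleton_le_iff_mem x N).2 ?_)
  rw [← hc]
  exact N.smul_mem c hyN

theorem isSemisimpleModule (he : TriangularIdempotents e) {i : ι} (h : ActsAsOne (e i) X) :
    IsSemisimpleModule B X := by
  refine .of_sSup_simples_eq_top (eq_top_iff.2 fun x _ => ?_)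
  by_cases hx : x = 0
  · simp [hx]
  · exact (le_sSup (he.isSimpleModule_span h hx) : Submodule.span B {x} ≤ _)
      (Submodule.mem_span_singleton_self x)

/-- Both modules are `B` modulo the annihilator of a nonzero vector, and these annihilators agree by
`smul_eq_zero_iff`. So there is at most one simple module per index, which also drives the later
count of simples. -/
theorem nonempty_linearEquiv (he : TriangularIdempotents e) [IsSimpleModule B X]
    [IsSimpleModule B Y] {i : ι} (hX : ActsAsOne (e i) X) (hY : ActsAsOne (e i) Y) :
    Nonempty (X ≃ₗ[B] Y) := by
  have := IsSimpleModule.nontrivial B X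
  have := IsSimpleModule.nontrivial B Y
  obtain ⟨x, hx⟩ := exists_ne (0 : X)
  obtain ⟨y, hy⟩ := exists_ne (0 : Y)
  have hker : LinearMap.ker (LinearMap.toSpanSingleton B X x) =
      LinearMap.ker (LinearMap.toSpanSingleton B Y y) := by
    ext b
    simp only [LinearMap.mem_ker, LinearMap.toSpanSingleton_apply]
    rw [he.smul_eq_zero_iff hX hx, he.smul_eq_zero_iff hY hy]
  exact ⟨((LinearMap.quotKerEquivOfSurjective _
    (IsSimpleModule.toSpanSingleton_surjective B hx)).symm.trans
    (Submodule.quotEquivOfEq _ _ hker)).trans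
    (LinearMap.quotKerEquivOfSurjective _ (IsSimpleModule.toSpanSingleton_surjective B hy))⟩

theorem exists_linearEquiv_finsupp (he : TriangularIdempotents e) {i : ι}
    {X : Type u} [AddCommGroup X] [Module B X] (hX : ActsAsOne (e i) X)
    [IsSimpleModule B Y] (hY : ActsAsOne (e i) Y) :
    ∃ ν : Type u, Nonempty (X ≃ₗ[B] (ν →₀ Y)) := by
  have := he.isSemisimpleModule hX
  exact IsIsotypicOfType.linearEquiv_finsupp fun m _ => he.nonempty_linearEquiv (hX.submodule m) hY

end TriangularIdempotents

/-! ### Modules detected by, or generated by, an idempotent. -/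

/-- Every nonzero element of `X` has a multiple on which `e` does not vanish. -/
def DetectedBy {B : Type*} [Ring B] (e : B) (X : Type*) [AddCommGroup X] [Module B X] : Prop :=
  ∀ x : X, x ≠ 0 → ∃ c : B, e • c • x ≠ 0

namespace DetectedBy

variable {B X Y : Type*} [Ring B] {e : B} [AddCommGroup X] [Module B X] [AddCommGroup Y]
  [Module B Y]

theorem of_injective (h : DetectedBy e Y) (f : X →ₗ[B] Y) (hf : Function.Injective f) :
    DetectedBy e X := fun x hx => by
  obtain ⟨c, hc⟩ := h (f x) ((map_ne_zero_iff f hf).2 hx)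
  exact ⟨c, fun h0 => hc (by rw [← map_smul, ← map_smul, h0, map_zero])⟩

theorem finsupp (h : DetectedBy e X) (ν : Type*) : DetectedBy e (ν →₀ X) := fun x hx => by
  obtain ⟨k, hk⟩ := Finsupp.ne_iff.1 hx
  obtain ⟨c, hc⟩ := h (x k) hk
  exact ⟨c, fun h0 => hc (by simpa using DFunLike.congr_fun h0 k)⟩

/-- A nonzero value of `f - g` would have a multiple not killed by `e`, but that is a value of `f -
g` on the `e`-part of `X`. This gives all uniqueness statements for maps into `Q^(ν)`. -/
theorem hom_ext (h : DetectedBy e Y) {f g : X →ₗ[B] Y} (hfg : ∀ x, f (e • x) = g (e • x)) :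
    f = g := by
  ext x
  by_contra hx
  obtain ⟨c, hc⟩ := h (f x - g x) (sub_ne_zero.2 hx)
  have : e • c • (f x - g x) = f (e • c • x) - g (e • c • x) := by simp only [map_smul, smul_sub]
  exact hc (by rw [this, hfg, sub_self])

theorem injective_of_forall (h : DetectedBy e X) (f : X →ₗ[B] Y)
    (hf : ∀ x, f (e • x) = 0 → e • x = 0) : Function.Injective f := by
  rw [injective_iff_map_eq_zero]
  intro x hx
  by_contra hx0
  obtain ⟨c, hc⟩ := h x hx0
  exact hc (hf _ (by rw [map_smul, map_smul, hx, smul_zero, smul_zero]))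

end DetectedBy

/-- The module `X` is generated by `e X`. -/
def GeneratedBy {B : Type*} [Ring B] (e : B) (X : Type*) [AddCommGroup X] [Module B X] : Prop :=
  Submodule.span B (Set.range fun x : X => e • x) = ⊤

namespace GeneratedBy

variable {B X Y : Type*} [Ring B] {e : B} [AddCommGroup X] [Module B X] [AddCommGroup Y]
  [Module B Y]

theorem le_of_forall_mem (h : GeneratedBy e X) {N : Submodule B X} (hN : ∀ x, e • x ∈ N) :
    N = ⊤ := by
  rw [eq_top_iff, ← (h : _ = ⊤), Submodule.span_le]
  rintro _ ⟨x, rfl⟩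
  exact hN x

theorem hom_ext (h : GeneratedBy e X) {f g : X →ₗ[B] Y} (hfg : ∀ x, f (e • x) = g (e • x)) :
    f = g :=
  LinearMap.ext_on (h : _ = ⊤) (by rintro _ ⟨x, rfl⟩; exact hfg x)

theorem of_surjective (h : GeneratedBy e X) (f : X →ₗ[B] Y) (hf : Function.Surjective f) :
    GeneratedBy e Y := by
  rw [GeneratedBy, eq_top_iff, ← LinearMap.range_eq_top.2 hf, ← Submodule.map_top,
    ← (h : _ = ⊤), Submodule.map_span_le]
  rintro _ ⟨x, rfl⟩
  exact Submodule.subset_span ⟨f x, by simp⟩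

theorem finsupp (h : GeneratedBy e X) (ν : Type*) : GeneratedBy e (ν →₀ X) := by
  rw [GeneratedBy, eq_top_iff, ← Finsupp.iSup_lsingle_range, iSup_le_iff]
  intro k
  rw [← Submodule.map_top, ← (h : _ = ⊤), Submodule.map_span_le]
  rintro _ ⟨x, rfl⟩
  exact Submodule.subset_span ⟨Finsupp.single k x, by simp⟩

end GeneratedBy

/-! ### Frames with a sink and a source; `Q` is projective and injective. -/

/-- Triangular idempotents of an Artinian ring `B` with a sink `s` and a source `o` such that
`B` is detected by `e s`, together with a module `Q ≃ B (e o)` such that homomorphisms from `(e s) Y`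
to direct sums of copies of `Q` extend to `Y`. -/
structure SocleFrame {B ι : Type u} [Ring B] [Fintype ι] [PartialOrder ι] (e : ι → B) (s o : ι)
    {Q : Type u} [AddCommGroup Q] [Module B Q] (q : Q) : Prop
    extends TriangularIdempotents e where
  least : ∀ i, s ≤ i
  greatest : ∀ i, i ≤ o
  artinian : IsArtinianRing B
  detected : DetectedBy (e s) B
  exists_ne_zero : ∀ j, ∃ r, e j * r * e o ≠ 0
  exists_mul_eq : ∀ b b', e s * b * e o ≠ 0 → ∃ c, c * (e s * b * e o) = e s * b' * e o
  smul_q : e o • q = q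
  span_q : Submodule.span B {q} = ⊤
  mul_eq_zero : ∀ b : B, b • q = 0 → b * e o = 0
  exists_extension : ∀ (ν Y : Type u) [AddCommGroup Y] [Module B Y] (N : Submodule B Y),
    (∀ y, y ∈ N ↔ e s • y = y) → ∀ φ : N →ₗ[B] (ν →₀ Q),
    ∃ h : Y →ₗ[B] (ν →₀ Q), ∀ y : N, h y = φ y

namespace SocleFrame

variable {B ι : Type u} [Ring B] [Fintype ι] [PartialOrder ι] {e : ι → B} {s o : ι}
    {Q : Type u} [AddCommGroup Q] [Module B Q] {q : Q} (H : SocleFrame e s o q)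
include H

/-- Insert `1 = ∑ e i` on the left: since `s` is least, only `i = s` survives. Consequently `(e s)
X` is a submodule. -/
theorem mul_sink (b : B) : b * e s = e s * b * e s := by
  conv_lhs => rw [← one_mul b, ← H.complete, Finset.sum_mul, Finset.sum_mul]
  exact Finset.sum_eq_single s (fun i _ hi =>
    H.eq_zero_of_not_le (fun h => hi (le_antisymm h (H.least i))) b) (by simp)

/-- Dual to `mul_sink`: since `o` is greatest, the kernel of `e o` on a module is a submodule. -/
theorem source_mul (b : B) : e o * b = e o * b * e o := by
  conv_lhs => rw [← mul_one (e o * b), ← H.complete, Finset.mul_sum]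
  exact Finset.sum_eq_single o (fun i _ hi =>
    H.eq_zero_of_not_le (fun h => hi (le_antisymm (H.greatest i) h)) b) (by simp)

theorem source_ne_zero : e o ≠ 0 := fun h => by
  obtain ⟨r, hr⟩ := H.exists_ne_zero o
  simp [h] at hr

section Module

variable (X : Type*) [AddCommGroup X] [Module B X]

/-- The submodule `(e s) X`. -/
def fixedPart : Submodule B X where
  carrier := {x | e s • x = x}
  add_mem' {x y} (hx : _ = _) (hy : _ = _) := by rw [Set.mem_ofPred_eq, smul_add, hx, hy]
  zero_mem' := smul_zero _
  smul_mem' b x (hx : _ = _) := by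
    rw [Set.mem_ofPred_eq, ← hx, smul_smul b, H.mul_sink, smul_smul, ← mul_assoc, ← mul_assoc,
      H.mul_self]

/-- The kernel of the action of `e o`. -/
def sourceKer : Submodule B X where
  carrier := {x | e o • x = 0}
  add_mem' {x y} (hx : _ = _) (hy : _ = _) := by rw [Set.mem_ofPred_eq, smul_add, hx, hy, add_zero]
  zero_mem' := smul_zero _
  smul_mem' b x (hx : _ = _) := by
    rw [Set.mem_ofPred_eq, smul_smul, H.source_mul, mul_smul, hx, smul_zero]

variable {X}

theorem mem_fixedPart {x : X} : x ∈ H.fixedPart X ↔ e s • x = x := Iff.rfl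

theorem mem_sourceKer {x : X} : x ∈ H.sourceKer X ↔ e o • x = 0 := Iff.rfl

theorem actsAsOne_fixedPart : ActsAsOne (e s) (H.fixedPart X) := fun x => Subtype.ext x.2

theorem smul_mem_fixedPart (x : X) : e s • x ∈ H.fixedPart X := by
  rw [mem_fixedPart, smul_smul, H.mul_self]

theorem actsAsOne_quotient_sourceKer : ActsAsOne (e o) (X ⧸ H.sourceKer X) := by
  intro x
  obtain ⟨x, rfl⟩ := Submodule.mkQ_surjective _ x
  rw [← sub_eq_zero, ← map_smul, ← map_sub, Submodule.mkQ_apply, Submodule.Quotient.mk_eq_zero,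
    mem_sourceKer, smul_sub, smul_smul, H.mul_self, sub_self]

/-- The homomorphism `Q → X` with `q ↦ (e o) x`. -/
theorem exists_hom (x : X) : ∃ φ : Q →ₗ[B] X, ∀ b : B, φ (b • q) = b • e o • x := by
  have hsurj : Function.Surjective (LinearMap.toSpanSingleton B Q q) := by
    rw [← LinearMap.range_eq_top, LinearMap.range_toSpanSingleton, H.span_q]
  refine ⟨(Submodule.liftQ _ (LinearMap.toSpanSingleton B X (e o • x)) fun b hb => ?_) ∘ₗ
    (LinearMap.quotKerEquivOfSurjective _ hsurj).symm.toLinearMap, fun b => ?_⟩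
  · rw [LinearMap.mem_ker, LinearMap.toSpanSingleton_apply] at hb ⊢
    rw [smul_smul, H.mul_eq_zero b hb, zero_smul]
  · have : (LinearMap.quotKerEquivOfSurjective _ hsurj).symm (b • q) = Submodule.Quotient.mk b := by
      rw [LinearEquiv.symm_apply_eq]
      rfl
    rw [LinearMap.comp_apply, LinearEquiv.coe_coe, this, Submodule.liftQ_apply,
      LinearMap.toSpanSingleton_apply]

theorem exists_eq_smul_q (y : Q) : ∃ b : B, b • q = y :=
  Submodule.mem_span_singleton.1 (H.span_q.ge Submodule.mem_top)

/-- By `exists_hom`, maps `Q → X` may be prescribed by an arbitrary element of `(e o) X`, and such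
elements lift along surjections. -/
theorem projective : Module.Projective B Q := by
  refine .of_lifting_property'' fun f hf => ?_
  obtain ⟨y, hy⟩ := hf q
  obtain ⟨φ, hφ⟩ := H.exists_hom y
  refine ⟨φ, LinearMap.ext fun z => ?_⟩
  obtain ⟨b, rfl⟩ := H.exists_eq_smul_q z
  rw [LinearMap.comp_apply, hφ, map_smul, map_smul, hy, H.smul_q, LinearMap.id_apply]

theorem smul_q_eq_zero_iff (b : B) : b • q = 0 ↔ b * e o = 0 :=
  ⟨H.mul_eq_zero b, fun h => by rw [← H.smul_q, smul_smul, h, zero_smul]⟩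

theorem detected_Q : DetectedBy (e s) Q := fun y hy => by
  obtain ⟨b, rfl⟩ := H.exists_eq_smul_q y
  obtain ⟨c, hc⟩ := H.detected (b * e o) fun h => hy ((H.smul_q_eq_zero_iff b).2 h)
  refine ⟨c, fun h => hc ?_⟩
  rw [smul_smul, smul_smul, H.smul_q_eq_zero_iff] at h
  simpa only [smul_eq_mul, mul_assoc] using h

theorem generated_Q : GeneratedBy (e o) Q := by
  rw [GeneratedBy, eq_top_iff, ← H.span_q, Submodule.span_le, Set.singleton_subset_iff]
  exact Submodule.subset_span ⟨q, H.smul_q⟩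

theorem detected_finsupp (ν : Type*) : DetectedBy (e s) (ν →₀ Q) := H.detected_Q.finsupp ν

theorem generated_finsupp (ν : Type*) : GeneratedBy (e o) (ν →₀ Q) := H.generated_Q.finsupp ν

/-- Semisimplicity of `(e s) Y` extends the restriction of `g` from `(e s) X` to `(e s) Y`, and
`exists_extension` carries it on to `Y`. The result agrees with `g` on `(e s) X`, hence on `X` by
detection. -/
theorem injective (ν : Type u) : Module.Injective B (ν →₀ Q) := by
  refine ⟨fun X Y _ _ _ _ f hf g => ?_⟩
  have := H.isSemisimpleModule (H.actsAsOne_fixedPart (X := Y))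
  let f' : H.fixedPart X →ₗ[B] H.fixedPart Y :=
    f.restrict fun x hx => by rw [mem_fixedPart] at hx ⊢; rw [← map_smul, hx]
  have hf' : Function.Injective f' := fun x y hxy =>
    Subtype.ext (hf (congr_arg Subtype.val hxy))
  obtain ⟨φ, hφ⟩ := IsSemisimpleModule.extension_property f' hf' (g ∘ₗ (H.fixedPart X).subtype)
  obtain ⟨h, hh⟩ := H.exists_extension ν Y (H.fixedPart Y) (fun _ => Iff.rfl) φ
  refine ⟨h, fun x => LinearMap.congr_fun (f := h ∘ₗ f)
    ((H.detected_finsupp ν).hom_ext fun x => ?_) x⟩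
  have h1 := LinearMap.congr_fun hφ ⟨_, H.smul_mem_fixedPart x⟩
  exact (hh (f' ⟨_, H.smul_mem_fixedPart x⟩)).trans h1

theorem injective_Q : Module.Injective B Q := by
  refine ⟨fun X Y _ _ _ _ f hf g => ?_⟩
  obtain ⟨h, hh⟩ := (H.injective PUnit).out f hf ((Finsupp.lsingle PUnit.unit) ∘ₗ g)
  exact ⟨(Finsupp.lapply PUnit.unit) ∘ₗ h, fun x => by simp [hh]⟩

end Module

/-! ### Descriptions of `CatU` and `CatV` by the sink and the source. -/

section Summand

variable {X : Type u} [AddCommGroup X] [Module B X]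

omit H in
theorem hasSummand_of_injective [Module.Injective B Q] (φ : Q →ₗ[B] X)
    (hφ : Function.Injective φ) : HasSummand B X Q := by
  obtain ⟨r, hr⟩ := Module.Injective.out φ hφ (LinearMap.id : Q →ₗ[B] Q)
  let E := LinearEquiv.ofInjective φ hφ
  refine ⟨LinearMap.range φ, _, LinearMap.isCompl_of_proj (f := E.toLinearMap ∘ₗ r) ?_, ⟨E.symm⟩⟩
  rintro ⟨_, x, rfl⟩
  ext
  simp [E, hr]

/-- The map `Q → X` with `q ↦ e o • x` is injective: any nonzero element of `e s B e o` generates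
all of it, so one nonzero element of `(e s) Q` in the kernel would force `e s • c • e o • x = 0`. As
`Q` is injective, the image splits off. -/
theorem hasSummand_of_smul_ne_zero {x : X} {c : B} (hx : e s • c • e o • x ≠ 0) :
    HasSummand B X Q := by
  have := H.injective_Q
  obtain ⟨φ, hφ⟩ := H.exists_hom x
  refine hasSummand_of_injective φ (H.detected_Q.injective_of_forall φ fun y hy => ?_)
  obtain ⟨b, rfl⟩ := H.exists_eq_smul_q y
  by_contra h0
  rw [smul_smul, H.smul_q_eq_zero_iff] at h0
  obtain ⟨d, hd⟩ := H.exists_mul_eq b c h0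
  refine hx ?_
  rw [smul_smul, hφ, smul_smul] at hy
  rw [smul_smul, smul_smul, ← hd, mul_smul, hy, smul_zero]

theorem exists_source_smul_ne_zero (h : HasSummand B X Q) : ∃ x : X, e o • x ≠ 0 := by
  obtain ⟨N, _, _, ⟨E⟩⟩ := h
  refine ⟨E.symm q, fun h0 => H.source_ne_zero ?_⟩
  have h1 : E.symm q = 0 := by
    ext
    rw [← H.smul_q, map_smul, N.coe_smul, h0, N.coe_zero]
  rw [LinearEquiv.map_eq_zero_iff] at h1
  simpa using H.mul_eq_zero 1 (by rw [h1, smul_zero])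

theorem exists_sink_smul_ne_zero (h : HasSummand B X Q) : ∃ x : X, e s • x ≠ 0 := by
  obtain ⟨N, _, _, ⟨E⟩⟩ := h
  have hq : q ≠ 0 := fun h0 => H.source_ne_zero (by simpa using H.mul_eq_zero 1 (by simp [h0]))
  obtain ⟨c, hc⟩ := (H.detected_Q.of_injective E.toLinearMap E.injective) (E.symm q)
    (by simpa using hq)
  exact ⟨c • E.symm q, fun h0 => hc (Subtype.ext h0)⟩

theorem not_hasSummand_iff_of_detected (hX : DetectedBy (e s) X) :
    ¬ HasSummand B X Q ↔ ∀ x : X, e o • x = 0 := by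
  refine ⟨fun h x => ?_, fun h h' => ?_⟩
  · by_contra hx
    obtain ⟨c, hc⟩ := hX _ hx
    exact h (H.hasSummand_of_smul_ne_zero hc)
  · obtain ⟨x, hx⟩ := H.exists_source_smul_ne_zero h'
    exact hx (h x)

theorem not_hasSummand_iff_of_generated (hX : GeneratedBy (e o) X) :
    ¬ HasSummand B X Q ↔ ∀ x : X, e s • x = 0 := by
  refine ⟨fun h x => ?_, fun h h' => ?_⟩
  · have key : ∀ (c : B) (y : X), e s • c • e o • y = 0 := fun c y => by
      by_contra hy
      exact h (H.hasSummand_of_smul_ne_zero hy)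
    have hx : x ∈ Submodule.span B (Set.range fun x : X => e o • x) := hX.ge Submodule.mem_top
    -- The multiplier `c` is carried along so that the span induction passes through scalars.
    have : ∀ c : B, e s • c • x = 0 := by
      induction hx using Submodule.span_induction with
      | mem x hx => obtain ⟨y, rfl⟩ := hx; exact fun c => key c y
      | zero => simp
      | add x y _ _ hx hy => intro c; rw [smul_add, smul_add, hx, hy, add_zero]
      | smul b x _ hx => intro c; rw [smul_smul c, hx]
    simpa using this 1
  · obtain ⟨x, hx⟩ := H.exists_sink_smul_ne_zero h'
    exact hx (h x)

/-- The module is `B (e s)`, with retraction `b ↦ b * e s` from `B`. -/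
theorem exists_simple_projective : ∃ Y : Submodule B B, IsSimpleModule B Y ∧
    Module.Projective B Y ∧ ActsAsOne (e s) Y := by
  let x : H.fixedPart B := ⟨e s, H.mul_self s⟩
  have hx : x ≠ 0 := fun h => by
    obtain ⟨c, hc⟩ := H.detected (e o) H.source_ne_zero
    have h0 : e s = 0 := congr_arg Subtype.val h
    simp [h0] at hc
  have := H.isSimpleModule_span H.actsAsOne_fixedPart hx
  let E := (Submodule.span B {x}).equivMapOfInjective (H.fixedPart B).subtype
    (Subtype.val_injective)
  have hA : ActsAsOne (e s) (Submodule.map (H.fixedPart B).subtype (Submodule.span B {x})) :=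
    (H.actsAsOne_fixedPart.submodule _).of_surjective E.toLinearMap E.surjective
  refine ⟨_, IsSimpleModule.congr E.symm, ?_, hA⟩
  have hmul : ∀ y ∈ Submodule.map (H.fixedPart B).subtype (Submodule.span B {x}), y * e s = y := by
    rintro _ ⟨y, hy, rfl⟩
    obtain ⟨b, rfl⟩ := Submodule.mem_span_singleton.1 hy
    change b * e s * e s = b * e s
    rw [mul_assoc, H.mul_self]
  refine Module.Projective.of_split (Submodule.subtype _)
    ((LinearMap.toSpanSingleton B B (e s)).codRestrict _ fun b => ?_) ?_
  · exact ⟨b • x, Submodule.smul_mem _ b (Submodule.mem_span_singleton_self x), rfl⟩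
  · ext y
    exact hmul y y.2

/-- Detection by `e s` makes `e s` act as identity on every simple submodule. So the socle is a
direct sum of copies of the projective simple module `B (e s)`. -/
theorem isSocleProjective_of_detected (hX : DetectedBy (e s) X) : IsSocleProjective B X := by
  have hle : moduleSocle B X ≤ H.fixedPart X := by
    refine sSup_le fun N (hN : IsSimpleModule B N) => ?_
    have := IsSimpleModule.nontrivial B N
    obtain ⟨y, hy⟩ := exists_ne (0 : N)
    obtain ⟨c, hc⟩ := hX.of_injective N.subtype N.subtype_injective y hy
    exact fun z hz => congr_arg Subtype.val (H.actsAsOne_of_isSimpleModule hc ⟨z, hz⟩)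
  obtain ⟨Y, hY, hP, hA⟩ := H.exists_simple_projective
  have hS : ActsAsOne (e s) (moduleSocle B X) := fun x => Subtype.ext (hle x.2)
  obtain ⟨ν, ⟨E⟩⟩ := H.exists_linearEquiv_finsupp hS hA
  classical
  exact Module.Projective.of_equiv (E.trans (finsuppLequivDFinsupp B)).symm

/-- If `x ≠ 0` has no multiple surviving `e s`, the Artinian property yields a simple submodule of
`B x`, which lies in the socle. A projective socle embeds in a free module, and free modules inherit
detection from `B`, a contradiction. -/
theorem detected_of_isSocleProjective (hX : IsSocleProjective B X) : DetectedBy (e s) X := by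
  have := H.artinian
  intro x hx
  by_contra! h
  have : Nontrivial (Submodule.span B {x}) := by
    rw [Submodule.nontrivial_iff_ne_bot]
    simpa using hx
  have : Module.Finite B (Submodule.span B {x}) := Module.Finite.span_singleton B x
  obtain ⟨N, hN⟩ := IsAtomic.exists_atom (Submodule B (Submodule.span B {x}))
  rw [← isSimpleModule_iff_isAtom] at hN
  let E := N.equivMapOfInjective (Submodule.span B {x}).subtype (Subtype.val_injective)
  have hN' : Submodule.map (Submodule.span B {x}).subtype N ≤ moduleSocle B X :=
    le_sSup (IsSimpleModule.congr E.symm)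
  have := IsSimpleModule.nontrivial B N
  obtain ⟨y, hy⟩ := exists_ne (0 : N)
  obtain ⟨b, hb⟩ := Submodule.mem_span_singleton.1 y.1.2
  let y' : moduleSocle B X := ⟨y.1.1, hN' ⟨y.1, y.2, rfl⟩⟩
  have hy' : y' ≠ 0 := fun h => hy (Subtype.ext (Subtype.ext (congr_arg Subtype.val h :)))
  obtain ⟨σ, hσ⟩ := Module.projective_def'.1 hX
  have hσi : Function.Injective σ :=
    Function.LeftInverse.injective (g := Finsupp.linearCombination B id)
      fun z => LinearMap.congr_fun hσ z
  obtain ⟨c, hc⟩ := (H.detected.finsupp _).of_injective σ hσi y' hy'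
  refine hc (Subtype.ext ?_)
  change e s • c • y.1.1 = 0
  rw [← hb, smul_smul c, h]

theorem mem_U_iff : (IsSocleProjective B X ∧ ¬ HasSummand B X Q) ↔
    DetectedBy (e s) X ∧ ∀ x : X, e o • x = 0 :=
  ⟨fun h => have h1 := H.detected_of_isSocleProjective h.1
    ⟨h1, (H.not_hasSummand_iff_of_detected h1).1 h.2⟩,
  fun h => ⟨H.isSocleProjective_of_detected h.1, (H.not_hasSummand_iff_of_detected h.1).2 h.2⟩⟩

/-- Maps into `X` kill every vector annihilated by `e o`. Hence the extension problem descends to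
the quotient of `Z` by the kernel of `e o`, which is semisimple. -/
theorem injective_of_actsAsOne (hX : ActsAsOne (e o) X) : Module.Injective B X := by
  refine ⟨fun Y Z _ _ _ _ f hf g => ?_⟩
  have := H.isSemisimpleModule (H.actsAsOne_quotient_sourceKer (X := Z))
  let p := (H.sourceKer Z).mkQ ∘ₗ f
  have hp : LinearMap.ker p ≤ LinearMap.ker g := fun y hy => by
    rw [LinearMap.mem_ker, LinearMap.comp_apply, Submodule.mkQ_apply,
      Submodule.Quotient.mk_eq_zero, mem_sourceKer, ← map_smul, map_eq_zero_iff f hf] at hy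
    rw [LinearMap.mem_ker, ← hX (g y), ← map_smul, hy, map_zero]
  obtain ⟨h, hh⟩ := IsSemisimpleModule.extension_property ((LinearMap.ker p).liftQ p le_rfl)
    (by rw [← LinearMap.ker_eq_bot, Submodule.ker_liftQ_eq_bot _ _ _ le_rfl])
    ((LinearMap.ker p).liftQ g hp)
  refine ⟨h ∘ₗ (H.sourceKer Z).mkQ, fun y => ?_⟩
  exact LinearMap.congr_fun hh (Submodule.Quotient.mk y)

/-- No maximal submodule contains `(e o) X`, so `e o` acts as identity on each simple quotient and
therefore on the top. -/
theorem hasInjectiveTop_of_generated (hX : GeneratedBy (e o) X) : HasInjectiveTop B X := by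
  refine H.injective_of_actsAsOne fun x => ?_
  obtain ⟨x, rfl⟩ := Submodule.mkQ_surjective _ x
  rw [← sub_eq_zero, ← map_smul, ← map_sub, Submodule.mkQ_apply, Submodule.Quotient.mk_eq_zero,
    Module.jacobson, Submodule.mem_sInf]
  intro m (hm : IsCoatom m)
  have := isSimpleModule_iff_isCoatom.2 hm
  have hz : ∃ z, e o • z ∉ m := by
    by_contra! hz
    exact hm.1 (hX.le_of_forall_mem hz)
  obtain ⟨z, hz⟩ := hz
  have hA : ActsAsOne (e o) (X ⧸ m) := H.actsAsOne_of_isSimpleModule (x := m.mkQ z) (by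
    rwa [← map_smul, Submodule.mkQ_apply, Ne, Submodule.Quotient.mk_eq_zero])
  have := hA (m.mkQ x)
  rwa [← sub_eq_zero, ← map_smul, ← map_sub, Submodule.mkQ_apply, Submodule.Quotient.mk_eq_zero]
    at this

/-- Off-diagonal elements act by zero on the top of a module. -/
theorem smul_top_eq_zero {j : ι} {b : B} (hb : e j * b * e j = 0) (x : X ⧸ Module.jacobson B X) :
    b • e j • x = 0 := by
  obtain ⟨x, rfl⟩ := Submodule.mkQ_surjective _ x
  rw [← map_smul, ← map_smul, Submodule.mkQ_apply, Submodule.Quotient.mk_eq_zero, Module.jacobson,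
    Submodule.mem_sInf]
  intro m (hm : IsCoatom m)
  have := isSimpleModule_iff_isCoatom.2 hm
  rw [← Submodule.Quotient.mk_eq_zero, ← Submodule.mkQ_apply, map_smul, map_smul]
  by_cases h0 : e j • m.mkQ x = 0
  · rw [h0, smul_zero]
  · have hA := H.actsAsOne_of_isSimpleModule h0
    rw [hA.smul_eq, hb, zero_smul]

/-- Suppose the submodule `N` generated by `(e o) X` is proper. Injectivity of the top makes a
vector `e j • w`, nonzero modulo `N`, divisible in the top by some `e j * r * e o`. Since `e o`
kills `X ⧸ N`, this is absurd after projecting to a semisimple quotient of `X ⧸ N`. -/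
theorem generated_of_hasInjectiveTop (hX : HasInjectiveTop B X) : GeneratedBy (e o) X := by
  by_contra hgen
  set N := Submodule.span B (Set.range fun x : X => e o • x) with hN
  have hne : ∃ j, ∃ w : X ⧸ N, e j • w ≠ 0 := by
    obtain ⟨x, hx⟩ : ∃ x, x ∉ N := by
      by_contra! h
      exact hgen (eq_top_iff.2 fun x _ => h x)
    have hx' : N.mkQ x ≠ 0 := by rwa [Submodule.mkQ_apply, Ne, Submodule.Quotient.mk_eq_zero]
    obtain ⟨j, hj⟩ := H.exists_smul_ne_zero hx'
    exact ⟨j, _, hj⟩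
  have hW0 : ∀ w : X ⧸ N, e o • w = 0 := fun w => by
    obtain ⟨x, rfl⟩ := N.mkQ_surjective w
    rw [← map_smul, Submodule.mkQ_apply, Submodule.Quotient.mk_eq_zero]
    exact Submodule.subset_span ⟨x, rfl⟩
  -- Maximality of `j` makes the kernel `C` of `e j` on `X ⧸ N` a submodule, because `e j * b * e k`
  -- can be nonzero only for `j ≤ k`.
  obtain ⟨j, hj⟩ := (Set.toFinite {j | ∃ w : X ⧸ N, e j • w ≠ 0}).exists_maximal hne
  obtain ⟨w, hw⟩ := hj.1
  have hmax : ∀ k, k ≠ j → j ≤ k → ∀ w : X ⧸ N, e k • w = 0 := fun k hk hjk w => by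
    by_contra h0
    exact hk (le_antisymm (hj.2 ⟨w, h0⟩ hjk) hjk)
  let C : Submodule B (X ⧸ N) :=
    { carrier := {x | e j • x = 0}
      add_mem' := fun {x y} (hx : _ = _) (hy : _ = _) => by
        rw [Set.mem_ofPred_eq, smul_add, hx, hy, add_zero]
      zero_mem' := smul_zero _
      smul_mem' := fun b x (hx : _ = _) => by
        rw [Set.mem_ofPred_eq, smul_smul, ← mul_one (e j * b), ← H.complete, Finset.mul_sum,
          Finset.sum_smul]
        refine Finset.sum_eq_zero fun k _ => ?_
        by_cases hk : k = j
        · rw [hk, mul_smul, hx, smul_zero]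
        · by_cases hjk : j ≤ k
          · rw [mul_smul, hmax k hk hjk, smul_zero]
          · rw [H.eq_zero_of_not_le hjk, zero_smul] }
  have hCA : ActsAsOne (e j) ((X ⧸ N) ⧸ C) := fun x => by
    obtain ⟨x, rfl⟩ := C.mkQ_surjective x
    rw [← sub_eq_zero, ← map_smul, ← map_sub, Submodule.mkQ_apply, Submodule.Quotient.mk_eq_zero]
    change e j • _ = 0
    rw [smul_sub, smul_smul, H.mul_self, sub_self]
  have := H.isSemisimpleModule hCA
  let p : X →ₗ[B] (X ⧸ N) ⧸ C := C.mkQ ∘ₗ N.mkQ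
  have hjac : Module.jacobson B X ≤ LinearMap.ker p := by
    refine (Module.le_comap_jacobson p).trans ?_
    rw [IsSemisimpleModule.jacobson_eq_bot, LinearMap.ker]
  let π := (Module.jacobson B X).liftQ p hjac
  obtain ⟨w, rfl⟩ := N.mkQ_surjective w
  obtain ⟨r, hr⟩ := H.exists_ne_zero j
  let r' := LinearMap.toSpanSingleton B B (e j * r * e o)
  let t := LinearMap.toSpanSingleton B (X ⧸ Module.jacobson B X)
    (e j • (Module.jacobson B X).mkQ w)
  have hrt : LinearMap.ker r' ≤ LinearMap.ker t := fun b hb => by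
    rw [LinearMap.mem_ker, LinearMap.toSpanSingleton_apply, smul_eq_mul] at hb
    rw [LinearMap.mem_ker, LinearMap.toSpanSingleton_apply]
    refine H.smul_top_eq_zero ?_ _
    by_contra hbj
    obtain ⟨c, hc⟩ := H.exists_left_inv j b hbj
    refine hr ?_
    calc e j * r * e o = c * (e j * b * e j) * r * e o := by rw [hc]
      _ = c * (e j * (b * (e j * r * e o))) := by simp only [mul_assoc]
      _ = 0 := by rw [hb, mul_zero, mul_zero]
  -- The map `e j * r * e o ↦ e j • w` from the left ideal generated by `e j * r * e o` to the top
  -- is well defined by `hrt`; it is extended to all of `B` and evaluated through `1`.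
  obtain ⟨h, hh⟩ := hX.out ((LinearMap.ker r').liftQ r' le_rfl)
    (by rw [← LinearMap.ker_eq_bot, Submodule.ker_liftQ_eq_bot _ _ _ le_rfl])
    ((LinearMap.ker r').liftQ t hrt)
  have h1 := hh (Submodule.Quotient.mk 1)
  simp only [Submodule.liftQ_apply, r', t, LinearMap.toSpanSingleton_apply, one_smul] at h1
  have h2 := congr_arg π h1
  rw [← mul_one (e j * r * e o), ← smul_eq_mul, map_smul, map_smul, mul_smul, map_smul] at h2
  have h3 : ∀ z : (X ⧸ N) ⧸ C, e o • z = 0 := fun z => by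
    obtain ⟨z, rfl⟩ := C.mkQ_surjective z
    rw [← map_smul, hW0, map_zero]
  rw [h3, smul_zero] at h2
  have h4 : π ((Module.jacobson B X).mkQ w) = C.mkQ (N.mkQ w) := rfl
  rw [h4, ← map_smul, Submodule.mkQ_apply, eq_comm, Submodule.Quotient.mk_eq_zero] at h2
  change e j • e j • _ = 0 at h2
  rw [smul_smul, H.mul_self] at h2
  exact hw h2

theorem mem_V_iff : (HasInjectiveTop B X ∧ ¬ HasSummand B X Q) ↔
    GeneratedBy (e o) X ∧ ∀ x : X, e s • x = 0 :=
  ⟨fun h => have h1 := H.generated_of_hasInjectiveTop h.1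
    ⟨h1, (H.not_hasSummand_iff_of_generated h1).1 h.2⟩,
  fun h => ⟨H.hasInjectiveTop_of_generated h.1, (H.not_hasSummand_iff_of_generated h.1).2 h.2⟩⟩

end Summand

end SocleFrame

/-! ### Injective envelopes by direct sums of copies of `Q`. -/

namespace SocleFrame

variable {B ι : Type u} [Ring B] [Fintype ι] [PartialOrder ι] {e : ι → B} {s o : ι}
    {Q : Type u} [AddCommGroup Q] [Module B Q] {q : Q} (H : SocleFrame e s o q)
include H

theorem projective_finsupp (ν : Type u) : Module.Projective B (ν →₀ Q) := by
  classical
  have := H.projective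
  exact Module.Projective.of_equiv (finsuppLequivDFinsupp B).symm

section Envelope

variable {X Y : Type u} [AddCommGroup X] [Module B X] [AddCommGroup Y] [Module B Y]

/-- An embedding into `Q^(ν)` whose image contains `(e s) Q^(ν)` is an injective envelope. -/
def sumEnvelope {ν : Type u} (f : X →ₗ[B] (ν →₀ Q)) (hf : Function.Injective f)
    (h : ∀ y, e s • y ∈ LinearMap.range f) : SumEnvelope B X Q where
  ν := ν
  map := f
  target_injective := H.injective ν
  map_injective := hf
  essential N hN := by
    rw [Submodule.eq_bot_iff]
    intro y hy
    by_contra h0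
    obtain ⟨c, hc⟩ := H.detected_finsupp ν y h0
    refine hc ((Submodule.mem_bot B).1 (hN ▸ ⟨N.smul_mem _ (N.smul_mem c hy), h _⟩))

/-- A nonzero `e s • y` generates a simple submodule; by essentiality it meets the image and so lies
in it. -/
theorem sink_smul_mem_range (E : SumEnvelope B X Q) (y : E.ν →₀ Q) :
    e s • y ∈ LinearMap.range E.map := by
  by_cases hy : e s • y = 0
  · rw [hy]
    exact zero_mem _
  · have h1 : Submodule.span B {e s • y} ⊓ LinearMap.range E.map ≠ ⊥ := fun h =>
      hy (by simpa using E.essential _ h)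
    obtain ⟨z, ⟨hz1, hz2⟩, hz⟩ := (Submodule.ne_bot_iff _).1 h1
    obtain ⟨b, rfl⟩ := Submodule.mem_span_singleton.1 hz1
    obtain ⟨c, hc⟩ := H.exists_smul_smul_eq H.actsAsOne_fixedPart
      (x := ⟨e s • y, H.smul_mem_fixedPart y⟩) (b := b)
      (fun h => hz (congr_arg Subtype.val h))
    have h2 : c • b • e s • y = e s • y := congr_arg Subtype.val hc
    rw [← h2]
    exact Submodule.smul_mem _ c hz2

/-- The image of the envelope contains the whole `e s`-part, and maps to a detected module are
determined there. -/
theorem envelope_hom_ext (E : SumEnvelope B X Q) (hY : DetectedBy (e s) Y)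
    {f g : (E.ν →₀ Q) →ₗ[B] Y} (h : f ∘ₗ E.map = g ∘ₗ E.map) : f = g :=
  hY.hom_ext fun y => by
    obtain ⟨x, hx⟩ := H.sink_smul_mem_range E y
    rw [← hx]
    exact LinearMap.congr_fun h x

omit H in
theorem exists_envelope_extension (E : SumEnvelope B X Q) (E' : SumEnvelope B Y Q) (f : X →ₗ[B] Y) :
    ∃ f' : (E.ν →₀ Q) →ₗ[B] (E'.ν →₀ Q), f' ∘ₗ E.map = E'.map ∘ₗ f := by
  obtain ⟨h, hh⟩ := E'.target_injective.out E.map E.map_injective (E'.map ∘ₗ f)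
  exact ⟨h, LinearMap.ext hh⟩

theorem existsUnique_extension (E : SumEnvelope B X Q) (E' : SumEnvelope B Y Q) (f : X →ₗ[B] Y) :
    ∃! f' : (E.ν →₀ Q) →ₗ[B] (E'.ν →₀ Q), f' ∘ₗ E.map = E'.map ∘ₗ f := by
  obtain ⟨f', hf'⟩ := exists_envelope_extension E E' f
  exact ⟨f', hf', fun g hg => H.envelope_hom_ext E (H.detected_finsupp _) (hg.trans hf'.symm)⟩

/-- Both `(e s) X` and `(e s) Q` are sums of copies of the same simple module. Embedding `(e s) X`
accordingly into `Q^(ν)` and extending by injectivity gives a map that is injective by detection. -/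
theorem exists_sumEnvelope (hX : DetectedBy (e s) X) : Nonempty (SumEnvelope B X Q) := by
  obtain ⟨c, hc⟩ := H.detected_Q q fun h => H.source_ne_zero (by
    simpa using H.mul_eq_zero 1 (by simp [h]))
  let y : H.fixedPart Q := ⟨_, H.smul_mem_fixedPart (c • q)⟩
  have hy : y ≠ 0 := fun h => hc (congr_arg Subtype.val h)
  have := H.isSimpleModule_span H.actsAsOne_fixedPart hy
  obtain ⟨ν, ⟨E⟩⟩ := H.exists_linearEquiv_finsupp (H.actsAsOne_fixedPart (X := X))
    (H.actsAsOne_fixedPart.submodule (Submodule.span B {y}))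
  let g : H.fixedPart X →ₗ[B] (ν →₀ Q) := Finsupp.mapRange.linearMap
    ((H.fixedPart Q).subtype ∘ₗ (Submodule.span B {y}).subtype) ∘ₗ E.toLinearMap
  have hg : Function.Injective g :=
    (Finsupp.mapRange_injective _ (map_zero _)
      (Subtype.val_injective.comp Subtype.val_injective)).comp E.injective
  obtain ⟨f, hf⟩ := (H.injective ν).out (H.fixedPart X).subtype (Subtype.val_injective) g
  have hfi : Function.Injective f := hX.injective_of_forall f fun x hx => by
    have := hf ⟨_, H.smul_mem_fixedPart x⟩
    rw [Submodule.subtype_apply, hx, eq_comm, map_eq_zero_iff g hg] at this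
    exact congr_arg Subtype.val this
  refine ⟨H.sumEnvelope f hfi fun z => ?_⟩
  -- The `e s`-part of `Q` is the simple submodule generated by `y`, so the image of `g` is all of
  -- `(e s) Q^(ν)`.
  have hz : ∀ a : Q, e s • a = 0 ∨ ∃ b : B, e s • a = b • (y : Q) := fun a => by
    obtain ⟨b, rfl⟩ := H.exists_eq_smul_q a
    have hc' : e s * c * e o ≠ 0 := by
      rw [smul_smul] at hc
      exact fun h => hc ((H.smul_q_eq_zero_iff _).2 h)
    obtain ⟨d, hd⟩ := H.exists_mul_eq c b hc'
    refine .inr ⟨d, ?_⟩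
    change e s • b • q = d • e s • c • q
    rw [← H.smul_q, smul_smul, smul_smul, ← hd, mul_smul, mul_smul, mul_smul]
  have hz' : e s • z ∈ LinearMap.range g := by
    induction z using Finsupp.induction_linear with
    | zero => rw [smul_zero]; exact zero_mem _
    | add z w hz hw => rw [smul_add]; exact add_mem hz hw
    | single k a =>
      rw [Finsupp.smul_single]
      obtain h | ⟨b, hb⟩ := hz a
      · rw [h, Finsupp.single_zero]; exact zero_mem _
      · refine ⟨E.symm (Finsupp.single k
          (b • ⟨y, Submodule.mem_span_singleton_self y⟩)), ?_⟩
        simp only [g, LinearMap.comp_apply, LinearEquiv.coe_coe, LinearEquiv.apply_symm_apply]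
        rw [Finsupp.mapRange.linearMap_apply, Finsupp.mapRange_single, hb]
        rfl
  obtain ⟨x, hx⟩ := hz'
  exact ⟨x, by rw [← hx]; exact hf x⟩

/-- Two injective envelopes of a module are isomorphic. -/
theorem exists_envelope_equiv (E E' : SumEnvelope B X Q) :
    ∃ α : (E.ν →₀ Q) ≃ₗ[B] (E'.ν →₀ Q), α.toLinearMap ∘ₗ E.map = E'.map := by
  obtain ⟨α, hα⟩ := exists_envelope_extension E E' LinearMap.id
  obtain ⟨β, hβ⟩ := exists_envelope_extension E' E LinearMap.id
  rw [LinearMap.comp_id] at hα hβ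
  refine ⟨LinearEquiv.ofLinearMap α β ?_ ?_, hα⟩
  · refine H.envelope_hom_ext E' (H.detected_finsupp _) ?_
    rw [LinearMap.comp_assoc, hβ, hα, LinearMap.id_comp]
  · refine H.envelope_hom_ext E (H.detected_finsupp _) ?_
    rw [LinearMap.comp_assoc, hα, hβ, LinearMap.id_comp]

theorem generated_cokernel (E : SumEnvelope B X Q) :
    GeneratedBy (e o) ((E.ν →₀ Q) ⧸ LinearMap.range E.map) :=
  (H.generated_finsupp E.ν).of_surjective _ (Submodule.mkQ_surjective _)

theorem sink_smul_cokernel (E : SumEnvelope B X Q) (y : (E.ν →₀ Q) ⧸ LinearMap.range E.map) :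
    e s • y = 0 := by
  obtain ⟨y, rfl⟩ := Submodule.mkQ_surjective _ y
  rw [← map_smul, Submodule.mkQ_apply, Submodule.Quotient.mk_eq_zero]
  exact H.sink_smul_mem_range E y

/-- A module generated by `(e o) Y` has a presentation `Q^(ν) → Y` whose kernel is annihilated
by `e o`. -/
theorem exists_cover (hY : GeneratedBy (e o) Y) : ∃ (ν : Type u) (p : (ν →₀ Q) →ₗ[B] Y),
    Function.Surjective p ∧ ∀ x ∈ LinearMap.ker p, e o • x = 0 := by
  let y : Q ⧸ H.sourceKer Q := Submodule.mkQ _ q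
  have hy : y ≠ 0 := by
    change Submodule.mkQ _ q ≠ 0
    rw [Submodule.mkQ_apply, Ne, Submodule.Quotient.mk_eq_zero, mem_sourceKer, H.smul_q]
    exact fun h => H.source_ne_zero (by simpa using H.mul_eq_zero 1 (by simp [h]))
  have h1 := H.isSimpleModule_span H.actsAsOne_quotient_sourceKer hy
  have h2 : Submodule.span B {y} = ⊤ := by
    rw [← Set.image_singleton, Submodule.span_image, H.span_q, Submodule.map_top,
      Submodule.range_mkQ]
  rw [h2] at h1
  have := IsSimpleModule.congr (Submodule.topEquiv (R := B) (M := Q ⧸ H.sourceKer Q)).symm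
  obtain ⟨ν, ⟨E⟩⟩ := H.exists_linearEquiv_finsupp
    (H.actsAsOne_quotient_sourceKer (X := Y)) (H.actsAsOne_quotient_sourceKer (X := Q))
  have := H.projective_finsupp ν
  let π : (ν →₀ Q) →ₗ[B] (ν →₀ Q ⧸ H.sourceKer Q) :=
    Finsupp.mapRange.linearMap (H.sourceKer Q).mkQ
  have hπ : Function.Surjective π :=
    Finsupp.mapRange_surjective _ (map_zero _) (Submodule.mkQ_surjective _)
  -- Modulo the kernels of `e o`, `p` is the isomorphism `E.symm`. Thus `p` reaches `(e o) Y`, which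
  -- generates `Y`, and `ker p` is annihilated by `e o`.
  obtain ⟨p, hp⟩ := Module.projective_lifting_property (H.sourceKer Y).mkQ
    (E.symm.toLinearMap ∘ₗ π) (Submodule.mkQ_surjective _)
  refine ⟨ν, p, ?_, fun x hx => ?_⟩
  · rw [← LinearMap.range_eq_top]
    refine hY.le_of_forall_mem fun y => ?_
    obtain ⟨x, hx⟩ := hπ (E ((H.sourceKer Y).mkQ y))
    have h3 : (H.sourceKer Y).mkQ (p x) = (H.sourceKer Y).mkQ y := by
      rw [← LinearMap.comp_apply, hp, LinearMap.comp_apply, hx, LinearEquiv.coe_coe,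
        LinearEquiv.symm_apply_apply]
    rw [← sub_eq_zero, ← map_sub, Submodule.mkQ_apply, Submodule.Quotient.mk_eq_zero,
      mem_sourceKer, smul_sub, sub_eq_zero] at h3
    exact ⟨e o • x, by rw [map_smul, h3]⟩
  · have h3 : π x = 0 := by
      have := LinearMap.congr_fun hp x
      rw [LinearMap.comp_apply, (LinearMap.mem_ker.1 hx), map_zero] at this
      simpa using this.symm
    ext k
    have h4 := DFunLike.congr_fun h3 k
    rw [Finsupp.mapRange.linearMap_apply, Finsupp.mapRange_apply, Finsupp.zero_apply,
      Submodule.mkQ_apply, Submodule.Quotient.mk_eq_zero] at h4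
    exact h4

end Envelope

/-! ### Extensions of a short exact sequence to the envelopes. -/

section Exact

variable {X₁ X₂ X₃ : Type u} [AddCommGroup X₁] [Module B X₁] [AddCommGroup X₂] [Module B X₂]
  [AddCommGroup X₃] [Module B X₃]

theorem extension_injective (E₁ : SumEnvelope B X₁ Q) (E₂ : SumEnvelope B X₂ Q) {f : X₁ →ₗ[B] X₂}
    (hf : Function.Injective f) {f' : (E₁.ν →₀ Q) →ₗ[B] (E₂.ν →₀ Q)}
    (hf' : f' ∘ₗ E₁.map = E₂.map ∘ₗ f) : Function.Injective f' := by
  refine (H.detected_finsupp _).injective_of_forall f' fun y hy => ?_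
  obtain ⟨x, hx⟩ := H.sink_smul_mem_range E₁ y
  rw [← hx, ← LinearMap.comp_apply, hf', LinearMap.comp_apply, map_eq_zero_iff _ E₂.map_injective,
    map_eq_zero_iff _ hf] at hy
  rw [← hx, hy, map_zero]

/-- On the semisimple `e s`-parts `g'` is surjective and has a section. Injectivity extends it to
`τ` with `g' ∘ τ = id`, as detection shows. -/
theorem extension_surjective (E₂ : SumEnvelope B X₂ Q) (E₃ : SumEnvelope B X₃ Q) {g : X₂ →ₗ[B] X₃}
    (hg : Function.Surjective g) {g' : (E₂.ν →₀ Q) →ₗ[B] (E₃.ν →₀ Q)}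
    (hg' : g' ∘ₗ E₂.map = E₃.map ∘ₗ g) : Function.Surjective g' := by
  have := H.isSemisimpleModule (H.actsAsOne_fixedPart (X := E₂.ν →₀ Q))
  let t : H.fixedPart (E₂.ν →₀ Q) →ₗ[B] H.fixedPart (E₃.ν →₀ Q) :=
    g'.restrict fun y hy => by rw [mem_fixedPart] at hy ⊢; rw [← map_smul, hy]
  have ht : Function.Surjective t := by
    rintro ⟨z, hz⟩
    obtain ⟨x, hx⟩ := H.sink_smul_mem_range E₃ z
    rw [H.mem_fixedPart.1 hz] at hx
    obtain ⟨w, rfl⟩ := hg x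
    refine ⟨⟨e s • E₂.map w, H.smul_mem_fixedPart _⟩, Subtype.ext ?_⟩
    change g' (e s • E₂.map w) = z
    rw [map_smul, ← LinearMap.comp_apply, hg', LinearMap.comp_apply, hx, hz]
  obtain ⟨σ, hσ⟩ := IsSemisimpleModule.lifting_property t ht LinearMap.id
  obtain ⟨τ, hτ⟩ := (H.injective E₂.ν).out (H.fixedPart (E₃.ν →₀ Q)).subtype
    Subtype.val_injective ((H.fixedPart (E₂.ν →₀ Q)).subtype ∘ₗ σ)
  have : g' ∘ₗ τ = LinearMap.id := (H.detected_finsupp _).hom_ext fun z => by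
    have h1 := hτ ⟨_, H.smul_mem_fixedPart z⟩
    have h2 := congr_arg Subtype.val (LinearMap.congr_fun hσ ⟨_, H.smul_mem_fixedPart z⟩)
    rw [LinearMap.comp_apply]
    exact (congr_arg g' h1).trans h2
  exact fun z => ⟨τ z, LinearMap.congr_fun this z⟩

/-- Let `ρ` be a retraction of the injective map `f'`. On the `e s`-part of `ker g'` exactness of
the given sequence shows that `f' ∘ ρ` is the identity, and detection extends this to `ker g'`. -/
theorem extension_exact (E₁ : SumEnvelope B X₁ Q) (E₂ : SumEnvelope B X₂ Q)
    (E₃ : SumEnvelope B X₃ Q) {f : X₁ →ₗ[B] X₂} {g : X₂ →ₗ[B] X₃} (hf : Function.Injective f)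
    (hfg : Function.Exact f g) {f' : (E₁.ν →₀ Q) →ₗ[B] (E₂.ν →₀ Q)}
    {g' : (E₂.ν →₀ Q) →ₗ[B] (E₃.ν →₀ Q)} (hf' : f' ∘ₗ E₁.map = E₂.map ∘ₗ f)
    (hg' : g' ∘ₗ E₂.map = E₃.map ∘ₗ g) : Function.Exact f' g' := by
  have hi := H.extension_injective E₁ E₂ hf hf'
  obtain ⟨ρ, hρ⟩ := (H.injective E₁.ν).out f' hi LinearMap.id
  have h0 : g' ∘ₗ f' = 0 := H.envelope_hom_ext E₁ (H.detected_finsupp _) (by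
    rw [LinearMap.comp_assoc, hf', ← LinearMap.comp_assoc, hg', LinearMap.comp_assoc,
      hfg.linearMap_comp_eq_zero, LinearMap.comp_zero, LinearMap.zero_comp])
  have key : (f' ∘ₗ ρ) ∘ₗ (LinearMap.ker g').subtype = (LinearMap.ker g').subtype := by
    refine (H.detected_finsupp _).hom_ext fun z => ?_
    obtain ⟨x, hx⟩ := H.sink_smul_mem_range E₂ z
    have h1 : g' (e s • z) = 0 := (e s • z).2
    rw [← hx, ← LinearMap.comp_apply, hg', LinearMap.comp_apply,
      map_eq_zero_iff _ E₃.map_injective] at h1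
    obtain ⟨w, rfl⟩ := (hfg x).1 h1
    have h2 : e s • (z : E₂.ν →₀ Q) = f' (E₁.map w) := by
      rw [← hx, ← LinearMap.comp_apply, ← hf', LinearMap.comp_apply]
    change f' (ρ (e s • (z : E₂.ν →₀ Q))) = e s • (z : E₂.ν →₀ Q)
    rw [h2, hρ, LinearMap.id_apply]
  intro y
  refine ⟨fun hy => ⟨ρ y, LinearMap.congr_fun key ⟨y, hy⟩⟩, ?_⟩
  rintro ⟨x, rfl⟩
  exact LinearMap.congr_fun h0 x

end Exact

/-! ### The cokernel functor is an exact equivalence. -/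

section Functor

variable (env : ∀ M : CatU B Q, SumEnvelope B M.obj Q)

/-- The chosen extension of a homomorphism to the injective envelopes. -/
noncomputable def extend {M N : CatU B Q} (f : M ⟶ N) :
    ((env M).ν →₀ Q) →ₗ[B] ((env N).ν →₀ Q) :=
  (H.existsUnique_extension (env M) (env N) (fullHom f)).choose

theorem extend_comp_map {M N : CatU B Q} (f : M ⟶ N) :
    H.extend env f ∘ₗ (env M).map = (env N).map ∘ₗ fullHom f :=
  (H.existsUnique_extension (env M) (env N) (fullHom f)).choose_spec.1

theorem eq_extend {M N : CatU B Q} (f : M ⟶ N) {f' : ((env M).ν →₀ Q) →ₗ[B] ((env N).ν →₀ Q)}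
    (h : f' ∘ₗ (env M).map = (env N).map ∘ₗ fullHom f) : f' = H.extend env f :=
  (H.existsUnique_extension (env M) (env N) (fullHom f)).choose_spec.2 f' h

theorem range_le_comap {M N : CatU B Q} (f : M ⟶ N) :
    LinearMap.range (env M).map ≤ (LinearMap.range (env N).map).comap (H.extend env f) := by
  rintro _ ⟨x, rfl⟩
  exact ⟨fullHom f x, (LinearMap.congr_fun (H.extend_comp_map env f) x).symm⟩

/-- The homomorphism induced on the cokernels of the injective envelopes. -/
noncomputable def cokernelMap {M N : CatU B Q} (f : M ⟶ N) :
    (((env M).ν →₀ Q) ⧸ LinearMap.range (env M).map) →ₗ[B]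
      (((env N).ν →₀ Q) ⧸ LinearMap.range (env N).map) :=
  Submodule.mapQ _ _ (H.extend env f) (H.range_le_comap env f)

theorem cokernelMap_id (M : CatU B Q) : H.cokernelMap env (𝟙 M) = LinearMap.id := by
  have : LinearMap.id = H.extend env (𝟙 M) := H.eq_extend env _ rfl
  refine LinearMap.ext fun x => ?_
  obtain ⟨x, rfl⟩ := Submodule.mkQ_surjective _ x
  rw [cokernelMap, Submodule.mkQ_apply, Submodule.mapQ_apply, ← this]
  rfl

theorem cokernelMap_comp {L M N : CatU B Q} (f : L ⟶ M) (g : M ⟶ N) :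
    H.cokernelMap env (f ≫ g) = H.cokernelMap env g ∘ₗ H.cokernelMap env f := by
  have : H.extend env g ∘ₗ H.extend env f = H.extend env (f ≫ g) := H.eq_extend env _ (by
    rw [LinearMap.comp_assoc, extend_comp_map, ← LinearMap.comp_assoc, extend_comp_map]
    rfl)
  refine LinearMap.ext fun x => ?_
  obtain ⟨x, rfl⟩ := Submodule.mkQ_surjective _ x
  rw [cokernelMap, Submodule.mkQ_apply, Submodule.mapQ_apply, ← this]
  rfl

/-- The functor of cokernels of the injective envelopes. -/
noncomputable def cokernelFunctor : CatU B Q ⥤ CatV B Q where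
  obj M := ⟨ModuleCat.of B (((env M).ν →₀ Q) ⧸ LinearMap.range (env M).map),
    H.mem_V_iff.2 ⟨H.generated_cokernel _, H.sink_smul_cokernel _⟩⟩
  map f := ObjectProperty.homMk (ModuleCat.ofHom (H.cokernelMap env f))
  map_id M := ObjectProperty.hom_ext _ (ModuleCat.hom_ext (H.cokernelMap_id env M))
  map_comp f g := ObjectProperty.hom_ext _ (ModuleCat.hom_ext (H.cokernelMap_comp env f g))

theorem isCokernelFunctor : IsCokernelFunctor env (H.cokernelFunctor env) := by
  refine ⟨fun M => Submodule.mkQ _, fun M => ⟨Submodule.mkQ_surjective _,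
    LinearMap.exact_map_mkQ_range _⟩, fun M N f => ⟨H.existsUnique_extension _ _ _, ?_⟩⟩
  intro f' hf'
  rw [H.eq_extend env f hf']
  rfl

/-- If two morphisms agree on cokernels, their extensions differ by a map into the image of `N`,
which `e o` kills. The source is generated by its `e o`-part, so the extensions coincide. -/
theorem cokernelFunctor_faithful : (H.cokernelFunctor env).Faithful := by
  refine ⟨fun {M N f g} hfg => ?_⟩
  have key : H.extend env f = H.extend env g := by
    refine (H.generated_finsupp _).hom_ext fun x => ?_
    have h1 : fullHom ((H.cokernelFunctor env).map f) (Submodule.mkQ _ x) =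
      fullHom ((H.cokernelFunctor env).map g) (Submodule.mkQ _ x) := by rw [hfg]
    change Submodule.mkQ _ (H.extend env f x) = Submodule.mkQ _ (H.extend env g x) at h1
    rw [← sub_eq_zero, ← map_sub, Submodule.mkQ_apply, Submodule.Quotient.mk_eq_zero] at h1
    obtain ⟨y, hy⟩ := h1
    rw [map_smul, map_smul, ← sub_eq_zero, ← smul_sub, ← hy, ← map_smul,
      (H.mem_U_iff.1 N.property).2, map_zero]
  have h2 : (env N).map ∘ₗ fullHom f = (env N).map ∘ₗ fullHom g := by
    rw [← H.extend_comp_map env f, ← H.extend_comp_map env g, key]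
  ext x
  exact (env N).map_injective (LinearMap.congr_fun h2 x)

/-- Projectivity of `Q^(ν)` lifts a map of cokernels; the lift restricts to the kernels of the
projections, that is, to `M → N`. -/
theorem cokernelFunctor_full : (H.cokernelFunctor env).Full := by
  refine ⟨fun {M N} g => ?_⟩
  have := H.projective_finsupp (env M).ν
  let g₀ : (((env M).ν →₀ Q) ⧸ LinearMap.range (env M).map) →ₗ[B]
    (((env N).ν →₀ Q) ⧸ LinearMap.range (env N).map) := fullHom g
  obtain ⟨g', hg'⟩ := Module.projective_lifting_property
    (LinearMap.range (env N).map).mkQ (g₀ ∘ₗ (LinearMap.range (env M).map).mkQ)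
    (Submodule.mkQ_surjective _)
  have hr : ∀ x, g' ((env M).map x) ∈ LinearMap.range (env N).map := fun x => by
    rw [← Submodule.Quotient.mk_eq_zero, ← Submodule.mkQ_apply, ← LinearMap.comp_apply, hg',
      LinearMap.comp_apply]
    have : (LinearMap.range (env M).map).mkQ ((env M).map x) = 0 := by
      rw [Submodule.mkQ_apply, Submodule.Quotient.mk_eq_zero]
      exact ⟨x, rfl⟩
    rw [this, map_zero]
  let f : M.obj →ₗ[B] N.obj := (LinearEquiv.ofInjective _ (env N).map_injective).symm.toLinearMap ∘ₗ
    (g' ∘ₗ (env M).map).codRestrict _ hr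
  have hf : g' ∘ₗ (env M).map = (env N).map ∘ₗ f := by
    ext1 x
    have := LinearEquiv.apply_symm_apply (LinearEquiv.ofInjective _ (env N).map_injective)
      ⟨_, hr x⟩
    exact (congr_arg Subtype.val this).symm
  refine ⟨ObjectProperty.homMk (ModuleCat.ofHom f), ?_⟩
  have h1 := H.eq_extend env (ObjectProperty.homMk (ModuleCat.ofHom f)) hf
  refine ObjectProperty.hom_ext _ (ModuleCat.hom_ext (LinearMap.ext fun x => ?_))
  obtain ⟨x, rfl⟩ := Submodule.mkQ_surjective _ x
  change Submodule.mkQ _ (H.extend env _ x) = _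
  rw [← h1]
  exact LinearMap.congr_fun hg' x

/-- The preimage is the kernel of a cover `p` from `exists_cover`. Its inclusion is an envelope
because `e s` kills `N`, and it is isomorphic to the chosen one. -/
theorem cokernelFunctor_essSurj : (H.cokernelFunctor env).EssSurj := by
  refine ⟨fun N => ?_⟩
  obtain ⟨hN1, hN2⟩ := H.mem_V_iff.1 N.property
  obtain ⟨ν, p, hp, hker⟩ := H.exists_cover hN1
  let M : CatU B Q := ⟨ModuleCat.of B (LinearMap.ker p), H.mem_U_iff.2
    ⟨(H.detected_finsupp ν).of_injective (LinearMap.ker p).subtype Subtype.val_injective,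
      fun x => Subtype.ext (hker x x.2)⟩⟩
  let E : SumEnvelope B M.obj Q := H.sumEnvelope (LinearMap.ker p).subtype Subtype.val_injective
    fun y => by
      rw [Submodule.range_subtype, LinearMap.mem_ker, map_smul, hN2]
  obtain ⟨α, hα⟩ : ∃ α : ((env M).ν →₀ Q) ≃ₗ[B] (ν →₀ Q),
    α.toLinearMap ∘ₗ (env M).map = (LinearMap.ker p).subtype := H.exists_envelope_equiv (env M) E
  have hmap : (LinearMap.range (env M).map).map α.toLinearMap = LinearMap.ker p := by
    rw [← LinearMap.range_comp, hα]
    exact Submodule.range_subtype _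
  let β := (Submodule.Quotient.equiv _ _ α hmap).trans (p.quotKerEquivOfSurjective hp)
  exact ⟨M, ⟨ObjectProperty.isoMk _ β.toModuleIso⟩⟩

/-- This is the nine lemma: the given sequence and the sequence of envelopes are exact, hence so is
the sequence of cokernels. -/
theorem isExactFunctor : IsExactFunctor (H.cokernelFunctor env) := by
  intro M₁ M₂ M₃ f g hf hfg hg
  have hf' := H.extend_comp_map env f
  have hg' := H.extend_comp_map env g
  have hex := H.extension_exact (env M₁) (env M₂) (env M₃) hf hfg hf' hg'
  have hsurj := H.extension_surjective (env M₂) (env M₃) hg hg'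
  have hmk : ∀ {M N : CatU B Q} (t : M ⟶ N) x,
      fullHom ((H.cokernelFunctor env).map t) (Submodule.mkQ _ x) =
        (LinearMap.range (env N).map).mkQ (H.extend env t x) := fun _ _ => rfl
  have hz : ∀ {M : CatU B Q} (x : (env M).ν →₀ Q),
      (LinearMap.range (env M).map).mkQ x = 0 ↔ ∃ m, (env M).map m = x := fun x => by
    rw [Submodule.mkQ_apply, Submodule.Quotient.mk_eq_zero, LinearMap.mem_range]
  refine ⟨?_, ?_, ?_⟩
  · refine (injective_iff_map_eq_zero (fullHom ((H.cokernelFunctor env).map f))).2 fun x hx => ?_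
    obtain ⟨x, rfl⟩ := Submodule.mkQ_surjective _ x
    rw [hmk f] at hx
    obtain ⟨m, hm⟩ := (hz _).1 hx
    have h1 : (env M₃).map (fullHom g m) = 0 := by
      rw [← LinearMap.comp_apply, ← hg', LinearMap.comp_apply, hm]
      exact hex.apply_apply_eq_zero x
    obtain ⟨n, rfl⟩ := (hfg m).1 ((map_eq_zero_iff _ (env M₃).map_injective).1 h1)
    refine (hz x).2 ⟨n, H.extension_injective (env M₁) (env M₂) hf hf' ?_⟩
    rw [← hm, ← LinearMap.comp_apply, hf', LinearMap.comp_apply]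
  · intro y
    obtain ⟨y, rfl⟩ := Submodule.mkQ_surjective _ y
    constructor
    · intro hy
      rw [hmk g] at hy
      obtain ⟨m, hm⟩ := (hz _).1 hy
      obtain ⟨m, rfl⟩ := hg m
      have h1 : H.extend env g (y - (env M₂).map m) = 0 := by
        rw [map_sub, ← hm, ← LinearMap.comp_apply (H.extend env g), hg', LinearMap.comp_apply,
          sub_self]
      obtain ⟨x, hx⟩ := (hex _).1 h1
      refine ⟨Submodule.mkQ _ x, ?_⟩
      rw [hmk f, hx, map_sub, (hz _).2 ⟨m, rfl⟩, sub_zero]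
    · rintro ⟨x, hx⟩
      obtain ⟨x, rfl⟩ := Submodule.mkQ_surjective _ x
      rw [← hx, hmk f, hmk g, hex.apply_apply_eq_zero, map_zero]
      rfl
  · intro z
    obtain ⟨z, rfl⟩ := Submodule.mkQ_surjective _ z
    obtain ⟨y, rfl⟩ := hsurj z
    exact ⟨Submodule.mkQ _ y, hmk g y⟩

theorem exists_cokernelFunctor : ∃ F : CatU B Q ⥤ CatV B Q,
    IsCokernelFunctor env F ∧ F.IsEquivalence ∧ IsExactFunctor F :=
  ⟨H.cokernelFunctor env, H.isCokernelFunctor env,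
    { faithful := H.cokernelFunctor_faithful env
      full := H.cokernelFunctor_full env
      essSurj := H.cokernelFunctor_essSurj env }, H.isExactFunctor env⟩

end Functor

end SocleFrame

/-! ### Matrix units of incidence algebras. -/

namespace MultSystem

variable {K A P : Type u} [Field K] [Ring A] [Algebra K A] [PartialOrder P]

namespace IncAlg

section Single

variable (R : MultSystem K A P)

open Classical in
/-- The matrix with the single entry `x` at `(i, j)`. -/
noncomputable def single (i j : P) : R.space i j →+ R.IncAlg where
  toFun x := ⟨fun k l => if k = i ∧ l = j then x else 0, fun k l => by
    by_cases h : k = i ∧ l = j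
    · obtain ⟨rfl, rfl⟩ := h; simp
    · simp [h]⟩
  map_zero' := ext' fun k l => by
    change (if k = i ∧ l = j then (0 : A) else 0) = 0
    simp
  map_add' x y := ext' fun k l => by
    change (if k = i ∧ l = j then (x + y : A) else 0) =
      (if k = i ∧ l = j then (x : A) else 0) + if k = i ∧ l = j then (y : A) else 0
    split_ifs <;> simp

variable {R}

open Classical in
theorem val_single {i j : P} (x : R.space i j) (k l : P) :
    (single R i j x).val k l = if k = i ∧ l = j then (x : A) else 0 := rfl

theorem val_single_same {i j : P} (x : R.space i j) : (single R i j x).val i j = x := by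
  rw [val_single, if_pos ⟨rfl, rfl⟩]

theorem single_injective (i j : P) : Function.Injective (single R i j) := fun x y h =>
  Subtype.ext (by rw [← val_single_same x, h, val_single_same])

theorem val_add (a b : R.IncAlg) (i j : P) : (a + b).val i j = a.val i j + b.val i j := rfl

theorem val_zero (i j : P) : (0 : R.IncAlg).val i j = 0 := rfl

theorem val_sum {α : Type*} (s : Finset α) (f : α → R.IncAlg) (i j : P) :
    (∑ a ∈ s, f a).val i j = ∑ a ∈ s, (f a).val i j := by
  classical
  induction s using Finset.induction_on with
  | empty => rfl
  | insert a s ha ih => rw [Finset.sum_insert ha, Finset.sum_insert ha, val_add, ih]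

theorem idem_eq_single (i : P) : idem R i = single R i i ⟨R.one i, R.one_mem i⟩ := rfl

variable [Fintype P]

theorem val_mul_apply (a b : R.IncAlg) (i l : P) :
    (a * b).val i l = ∑ j, a.val i j * b.val j l := rfl

theorem single_mul_single {i j l : P} (x : R.space i j) (y : R.space j l) :
    single R i j x * single R j l y = single R i l ⟨x * y, R.mul_mem' i j l x.2 y.2⟩ := by
  classical
  refine ext' fun m n => ?_
  simp only [val_mul_apply, val_single]
  rw [Finset.sum_eq_single j (fun k _ hk => by simp [hk]) (by simp)]
  by_cases h1 : m = i <;> by_cases h2 : n = l <;> simp [h1, h2]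

theorem single_mul_single_of_ne {i j k l : P} (h : j ≠ k) (x : R.space i j) (y : R.space k l) :
    single R i j x * single R k l y = 0 := by
  classical
  refine ext' fun m n => ?_
  simp only [val_mul_apply, val_single, val_zero]
  refine Finset.sum_eq_zero fun p _ => ?_
  by_cases h1 : p = j
  · simp [h1, h]
  · simp [h1]

theorem sum_single (a : R.IncAlg) :
    ∑ i, ∑ j, single R i j ⟨a.val i j, a.val_mem i j⟩ = a := by
  classical
  refine ext' fun m n => ?_
  simp only [val_sum, val_single]
  rw [Finset.sum_eq_single m (fun i _ hi => Finset.sum_eq_zero fun j _ => by simp [hi.symm])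
    (by simp), Finset.sum_eq_single n (fun j _ hj => by simp [hj.symm]) (by simp)]
  simp

theorem idem_mul_single {i j : P} (x : R.space i j) : idem R i * single R i j x = single R i j x := by
  rw [idem_eq_single, single_mul_single]
  exact congr_arg _ (Subtype.ext (R.one_mul' i j x.2))

theorem single_mul_idem {i j : P} (x : R.space i j) : single R i j x * idem R j = single R i j x := by
  rw [idem_eq_single, single_mul_single]
  exact congr_arg _ (Subtype.ext (R.mul_one' i j x.2))

theorem idem_mul_idem (i : P) : idem R i * idem R i = idem R i :=
  idem_mul_single ⟨R.one i, R.one_mem i⟩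

theorem sum_idem : ∑ i, idem R i = 1 := by
  classical
  refine ext' fun m n => ?_
  simp only [val_sum, idem_eq_single, val_single, val_one]
  by_cases h : m = n
  · subst h
    rw [Finset.sum_eq_single m (fun i _ hi => by simp [hi.symm]) (by simp)]
    simp
  · rw [if_neg h]
    exact Finset.sum_eq_zero fun i _ => if_neg fun hi => h (hi.1.trans hi.2.symm)

theorem idem_mul_mul_idem (i j : P) (a : R.IncAlg) :
    idem R i * a * idem R j = single R i j ⟨a.val i j, a.val_mem i j⟩ := by
  classical
  conv_lhs => rw [← sum_single a, Finset.mul_sum, Finset.sum_mul]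
  rw [Finset.sum_eq_single i, Finset.mul_sum, Finset.sum_mul, Finset.sum_eq_single j,
    idem_mul_single, single_mul_idem]
  · intro l _ hl
    rw [idem_eq_single j, mul_assoc, single_mul_single_of_ne hl, mul_zero]
  · simp
  · intro k _ hk
    rw [Finset.mul_sum, Finset.sum_mul]
    refine Finset.sum_eq_zero fun l _ => ?_
    rw [idem_eq_single i, single_mul_single_of_ne hk.symm, zero_mul]
  · simp

theorem completeOrthogonalIdempotents : CompleteOrthogonalIdempotents (idem R) where
  idem := idem_mul_idem
  ortho i j h := by
    change idem R i * idem R j = 0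
    rw [idem_eq_single, idem_eq_single, single_mul_single_of_ne h]
  complete := sum_idem

theorem le_of_idem_mul_mul_idem_ne_zero {i j : P} {a : R.IncAlg} (h : idem R i * a * idem R j ≠ 0) :
    i ≤ j := by
  by_contra hij
  refine h ?_
  rw [idem_mul_mul_idem]
  have : (⟨a.val i j, a.val_mem i j⟩ : R.space i j) = 0 := Subtype.ext (by
    have := a.val_mem i j
    rwa [R.space_eq_bot i j hij, Submodule.mem_bot] at this)
  rw [this, map_zero]

end Single

variable {R : MultSystem K A P} [Fintype P]
  (hR : ∀ i, ∀ x ∈ R.space i i, x ≠ 0 → ∃ y ∈ R.space i i, x * y = R.one i ∧ y * x = R.one i)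
include hR

theorem exists_inv {i : P} {a : R.IncAlg} (h : idem R i * a * idem R i ≠ 0) :
    ∃ c, (idem R i * a * idem R i) * c = idem R i ∧ c * (idem R i * a * idem R i) = idem R i := by
  rw [idem_mul_mul_idem] at h ⊢
  obtain ⟨y, hy, h1, h2⟩ := hR i _ (a.val_mem i i) fun h0 => h (by
    rw [show (⟨a.val i i, a.val_mem i i⟩ : R.space i i) = 0 from Subtype.ext h0, map_zero])
  refine ⟨single R i i ⟨y, hy⟩, ?_, ?_⟩
  · rw [single_mul_single, idem_eq_single]
    exact congr_arg _ (Subtype.ext h1)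
  · rw [single_mul_single, idem_eq_single]
    exact congr_arg _ (Subtype.ext h2)

theorem triangularIdempotents : TriangularIdempotents (idem R) where
  toCompleteOrthogonalIdempotents := completeOrthogonalIdempotents
  le_of_ne_zero _ _ _ := le_of_idem_mul_mul_idem_ne_zero
  exists_left_inv _ _ h := (exists_inv hR h).imp fun _ hc => hc.2

/-- Passing to the opposite ring exchanges the corners at `(i, j)` and `(j, i)`, hence the dual
order. -/
theorem triangularIdempotents_op :
    TriangularIdempotents fun i : Pᵒᵈ => MulOpposite.op (idem R (OrderDual.ofDual i)) where
  idem i := congr_arg MulOpposite.op (idem_mul_idem _)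
  ortho i j h := congr_arg MulOpposite.op
    (completeOrthogonalIdempotents.ortho (i := OrderDual.ofDual j) (j := OrderDual.ofDual i) h.symm)
  complete := by
    rw [← Finset.op_sum]
    exact congr_arg MulOpposite.op ((OrderDual.ofDual.sum_comp (idem R)).trans sum_idem)
  le_of_ne_zero i j b h := by
    change OrderDual.ofDual j ≤ OrderDual.ofDual i
    refine le_of_idem_mul_mul_idem_ne_zero (R := R) (i := OrderDual.ofDual j)
      (j := OrderDual.ofDual i) (a := MulOpposite.unop b) fun h0 => h ?_
    rw [← MulOpposite.op_unop b, ← MulOpposite.op_mul, ← MulOpposite.op_mul, ← mul_assoc, h0,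
      MulOpposite.op_zero]
  exists_left_inv i b h := by
    have hb : MulOpposite.op (idem R (OrderDual.ofDual i)) * b *
        MulOpposite.op (idem R (OrderDual.ofDual i)) = MulOpposite.op
        (idem R (OrderDual.ofDual i) * MulOpposite.unop b * idem R (OrderDual.ofDual i)) := by
      rw [mul_assoc (idem R _)]
      rfl
    rw [hb] at h ⊢
    obtain ⟨c, hc, _⟩ := exists_inv hR (a := MulOpposite.unop b)
      fun h0 => h (congr_arg MulOpposite.op h0)
    exact ⟨MulOpposite.op c, congr_arg MulOpposite.op hc⟩

end IncAlg

theorem mem_corner {T : MultSystem K A P} {ε : P → A} {hε : T.IsIdemFamily ε} {i j : P} {x : A} :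
    x ∈ (T.corner ε hε).space i j ↔ x ∈ T.space i j ∧ ε i * x = x ∧ x * ε j = x := by
  constructor
  · intro hx
    refine ⟨?_, (T.corner ε hε).one_mul' i j hx, (T.corner ε hε).mul_one' i j hx⟩
    obtain ⟨y, hy, rfl⟩ := hx
    exact T.mul_mem' i i j (hε.mem i) (T.mul_mem' i j j hy (hε.mem j))
  · rintro ⟨h1, h2, h3⟩
    exact ⟨x, h1, by simp [h2, h3]⟩

end MultSystem

/-! ### Fullness of `ε_𝔪` in `A`. -/

/-- The idempotent `e` is full: `∑ a k * b k = 1` with `a k ∈ A e` and `b k ∈ e A`. -/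
structure FullIdempotent {A : Type*} [Ring A] (e : A) where
  n : ℕ
  a : Fin n → A
  b : Fin n → A
  a_mul : ∀ k, a k * e = a k
  mul_b : ∀ k, e * b k = b k
  sum_eq_one : ∑ k, a k * b k = 1

theorem rightIdeal_mem {B : Type u} [Ring B] {e : B} (he : e * e = e) {x : B} :
    x ∈ rightIdeal e ↔ e * x = x := by
  rw [Submodule.mem_span_singleton]
  constructor
  · rintro ⟨c, rfl⟩
    rw [← MulOpposite.op_unop c, op_smul_eq_mul, ← mul_assoc, he]
  · intro h
    exact ⟨MulOpposite.op x, by rw [op_smul_eq_mul, h]⟩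

namespace MultSystem.IsExtendable

variable {K A P : Type u} [Field K] [Ring A] [Algebra K A] [PartialOrder P] [Fintype P]
  {T : MultSystem K A P} {ε : WithTop P → A}

/-- If `A ε_𝔪 A` were proper, it would lie in a maximal right ideal `m`. Then `ε_𝔪` kills `A ⧸ m`,
although this simple module is isomorphic to `ε_𝔪 A`, where `ε_𝔪 * ε_𝔪 = ε_𝔪 ≠ 0`. -/
theorem nonempty_fullIdempotent (h : T.IsExtendable ε) : Nonempty (FullIdempotent (ε ⊤)) := by
  have hid : ε ⊤ * ε ⊤ = ε ⊤ := h.idemFamily.idem ⊤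
  let I : Submodule Aᵐᵒᵖ A := Submodule.span Aᵐᵒᵖ (Set.range fun a : A => a * ε ⊤)
  have htop : I = ⊤ := by
    by_contra hne
    have hfin : Module.Finite Aᵐᵒᵖ A := Module.Finite.of_surjective
      (LinearMap.toSpanSingleton Aᵐᵒᵖ A 1) fun a => ⟨MulOpposite.op a, by simp⟩
    obtain ⟨m, hm, hle⟩ := (eq_top_or_exists_le_coatom I).resolve_left hne
    have := isSimpleModule_iff_isCoatom.2 hm
    obtain ⟨E⟩ := h.simple_unique (A ⧸ m) this
    have h0 : MulOpposite.op (ε ⊤) • E.symm ⟨ε ⊤, Submodule.mem_span_singleton_self _⟩ = 0 := by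
      obtain ⟨x, hx⟩ := m.mkQ_surjective (E.symm ⟨ε ⊤, Submodule.mem_span_singleton_self _⟩)
      rw [← hx, ← map_smul, Submodule.mkQ_apply, Submodule.Quotient.mk_eq_zero,
        op_smul_eq_mul]
      exact hle (Submodule.subset_span ⟨x, rfl⟩)
    rw [← map_smul, LinearEquiv.map_eq_zero_iff] at h0
    refine h.admissible.one_ne_zero ⊤ ?_
    have h1 := congr_arg Subtype.val h0
    exact hid.symm.trans h1
  have h1 : (1 : A) ∈ I := htop ▸ Submodule.mem_top
  have : ∃ (n : ℕ) (a b : Fin n → A), ∑ k, a k * ε ⊤ * b k = 1 := by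
    obtain ⟨c, hc⟩ := (Finsupp.mem_span_range_iff_exists_finsupp).1 h1
    let E := c.support.equivFin
    refine ⟨_, fun k => (E.symm k : A), fun k => MulOpposite.unop (c (E.symm k)), ?_⟩
    rw [← hc, Finsupp.sum, ← Finset.sum_coe_sort c.support]
    refine (E.symm.sum_comp fun a => (a : A) * ε ⊤ * MulOpposite.unop (c a)).trans
      (Finset.sum_congr rfl fun a _ => ?_)
    rw [← MulOpposite.op_unop (c a), op_smul_eq_mul, MulOpposite.unop_op]
  obtain ⟨n, a, b, hab⟩ := this
  exact ⟨⟨n, fun k => a k * ε ⊤, fun k => ε ⊤ * b k, fun k => by rw [mul_assoc, hid],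
    fun k => by rw [← mul_assoc, hid], by
      rw [← hab]
      exact Finset.sum_congr rfl fun k _ => by rw [mul_assoc, ← mul_assoc (ε ⊤), hid, mul_assoc]⟩⟩

end MultSystem.IsExtendable

theorem FullIdempotent.mul_left_sum {A : Type*} [Ring A] {e : A} (F : FullIdempotent e) (x y : A) :
    ∑ k, x * F.a k * (F.b k * y) = x * y := by
  have : ∀ k, x * F.a k * (F.b k * y) = x * (F.a k * F.b k) * y := fun k => by
    simp only [mul_assoc]
  rw [Finset.sum_congr rfl fun k _ => this k, ← Finset.sum_mul, ← Finset.mul_sum, F.sum_eq_one,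
    mul_one]

/-! ### The algebra `Λ` carries a frame: extension of maps to sums of copies of `e_0 Λ`. -/

namespace MultSystem.IsExtendable

variable {K A P : Type u} [Field K] [Ring A] [Algebra K A] [PartialOrder P] [Fintype P]
  {T : MultSystem K A P} {ε : WithTop P → A} (h : T.IsExtendable ε)

/-- The largest element of the extended poset. -/
abbrev sink (P : Type u) : WithBot (WithTop P) := ((⊤ : WithTop P) : WithBot (WithTop P))

open IncAlg MulOpposite

include h in
theorem idem_top : ε ⊤ * ε ⊤ = ε ⊤ := h.idemFamily.idem ⊤

include h in
theorem botIdem_mul_self (i : WithBot (WithTop P)) : botIdem ε i * botIdem ε i = botIdem ε i :=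
  h.botIdem_isIdemFamily.idem i

theorem mem_space_sink {i : WithBot (WithTop P)} {x : A} :
    x ∈ h.system.space i (sink P) ↔ botIdem ε i * x = x ∧ x * ε ⊤ = x := by
  refine mem_corner.trans ⟨fun hx => hx.2, fun hx => ⟨?_, hx⟩⟩
  induction i using WithBot.recBotCoe with
  | bot => trivial
  | coe i => induction i using WithTop.recTopCoe <;> trivial

theorem mem_space_bot {i : WithBot (WithTop P)} {x : A} :
    x ∈ h.system.space ⊥ i ↔ ε ⊤ * x = x ∧ x * botIdem ε i = x :=
  mem_corner.trans ⟨fun hx => hx.2, fun hx => ⟨trivial, hx⟩⟩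

/-- Since `ε_0 = ε_𝔪`, the spaces at `(0, 0)`, `(0, 𝔪)` and `(𝔪, 𝔪)` are all the division ring `ε_𝔪
A ε_𝔪`. This coincidence allows entries to be shifted from `𝔪` to `0`. -/
theorem space_sink_sink : h.system.space (sink P) (sink P) = h.system.space ⊥ ⊥ :=
  Submodule.ext fun _ => (h.mem_space_sink (i := sink P)).trans (h.mem_space_bot (i := ⊥)).symm

theorem space_bot_sink : h.system.space ⊥ (sink P) = h.system.space ⊥ ⊥ :=
  Submodule.ext fun _ => (h.mem_space_sink (i := ⊥)).trans (h.mem_space_bot (i := ⊥)).symm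

theorem system_exists_inv (i : WithBot (WithTop P)) : ∀ x ∈ h.system.space i i, x ≠ 0 →
    ∃ y ∈ h.system.space i i, x * y = h.system.one i ∧ y * x = h.system.one i := by
  induction i using WithBot.recBotCoe with
  | bot =>
    rw [← h.space_sink_sink]
    exact h.admissible.exists_inv ⊤
  | coe i => exact h.admissible.exists_inv i

theorem system_one_ne_zero (i : WithBot (WithTop P)) : h.system.one i ≠ 0 := by
  induction i using WithBot.recBotCoe with
  | bot => exact h.admissible.one_ne_zero ⊤
  | coe i => exact h.admissible.one_ne_zero i

theorem one_mul_mem {i j : WithBot (WithTop P)} (x : h.system.space i j) :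
    botIdem ε i * (x : A) = x := h.system.one_mul' i j x.2

theorem mul_one_mem {i j : WithBot (WithTop P)} (x : h.system.space i j) :
    (x : A) * botIdem ε j = x := h.system.mul_one' i j x.2

variable (F : FullIdempotent (ε ⊤))

/-- The element `ε_i a_k` of `ε_i A ε_𝔪`. -/
def toSink (i : WithBot (WithTop P)) (k : Fin F.n) : h.system.space i (sink P) :=
  ⟨botIdem ε i * F.a k, h.mem_space_sink.2
    ⟨by rw [← mul_assoc, h.botIdem_mul_self], by rw [mul_assoc, F.a_mul]⟩⟩

/-- The element `b_k ε_i` of `ε_0 A ε_i`. -/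
def fromBot (i : WithBot (WithTop P)) (k : Fin F.n) : h.system.space ⊥ i :=
  ⟨F.b k * botIdem ε i, h.mem_space_bot.2
    ⟨by rw [← mul_assoc, F.mul_b], by rw [mul_assoc, h.botIdem_mul_self]⟩⟩

/-- From `x = ∑ x a_k b_k` some `x a_k` is nonzero. This is the detection of `Λ` by the sink. -/
theorem exists_mul_toSink_ne_zero {i j : WithBot (WithTop P)} {x : h.system.space i j}
    (hx : x ≠ 0) : ∃ k, (x : A) * h.toSink F j k ≠ 0 := by
  by_contra! h0
  have h1 := F.mul_left_sum (x : A) (botIdem ε j)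
  rw [h.mul_one_mem x] at h1
  refine hx (Subtype.ext (h1.symm.trans (Finset.sum_eq_zero fun k _ => ?_)))
  have h2 : (x : A) * F.a k = 0 := by
    rw [← h.mul_one_mem x, mul_assoc]
    exact h0 k
  rw [h2, zero_mul]

theorem idem_bot_mem : idem h.system ⊥ ∈ h.E₀ := Submodule.mem_span_singleton_self _

theorem mem_E₀ {x : h.Alg} : x ∈ h.E₀ ↔ idem h.system ⊥ * x = x := rightIdeal_mem (idem_mul_idem _)

theorem single_bot_mem {j : WithBot (WithTop P)} (x : h.system.space ⊥ j) :
    single h.system ⊥ j x ∈ h.E₀ := h.mem_E₀.2 (idem_mul_single x)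

theorem ext_E₀ {x y : h.E₀} (hxy : ∀ i, (x : h.Alg).val ⊥ i = (y : h.Alg).val ⊥ i) : x = y := by
  classical
  have key : ∀ z : h.E₀, ∀ k i, k ≠ ⊥ → (z : h.Alg).val k i = 0 := fun z k i hk => by
    rw [← h.mem_E₀.1 z.2, val_mul_apply]
    refine Finset.sum_eq_zero fun l _ => ?_
    rw [idem_eq_single, val_single, if_neg fun h => hk h.1, zero_mul]
  refine Subtype.ext (ext' fun k i => ?_)
  by_cases hk : k = ⊥
  · rw [hk, hxy]
  · rw [key x k i hk, key y k i hk]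

/-- The additive map of `e_0 Λ` that moves the entry at `𝔪` to `0`. -/
noncomputable def shift : h.E₀ →+ h.E₀ where
  toFun x := ⟨single h.system ⊥ ⊥ ⟨(x : h.Alg).val ⊥ (sink P),
    h.space_bot_sink.le (val_mem (x : h.Alg) ⊥ (sink P))⟩, h.single_bot_mem _⟩
  map_zero' := Subtype.ext ((congr_arg _ (Subtype.ext rfl)).trans (map_zero (single h.system ⊥ ⊥)))
  map_add' x y := Subtype.ext (by
    change single h.system ⊥ ⊥ _ = single h.system ⊥ ⊥ _ + single h.system ⊥ ⊥ _
    rw [← map_add]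
    rfl)

theorem val_mul_single {i j k : WithBot (WithTop P)} (a : h.Alg) (x : h.system.space i j) :
    (a * single h.system i j x).val k j = a.val k i * x := by
  classical
  rw [val_mul_apply, Finset.sum_eq_single i, val_single_same]
  · intro l _ hl
    rw [val_single, if_neg fun h => hl h.1, mul_zero]
  · simp

theorem shift_smul (x : h.E₀) (d : h.system.space (sink P) (sink P)) :
    h.shift (op (single h.system _ _ d) • x) =
      op (single h.system ⊥ ⊥ ⟨d, h.space_sink_sink.le d.2⟩) • h.shift x := by
  refine Subtype.ext ?_
  change single h.system ⊥ ⊥ _ = single h.system ⊥ ⊥ _ * single h.system ⊥ ⊥ _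
  rw [single_mul_single]
  exact congr_arg _ (Subtype.ext (h.val_mul_single _ _))

theorem smul_shift (x : h.E₀) :
    op (single h.system ⊥ (sink P) ⟨ε ⊤, h.mem_space_sink.2 ⟨h.idem_top, h.idem_top⟩⟩) • h.shift x =
      op (idem h.system (sink P)) • x := by
  classical
  refine h.ext_E₀ fun k => ?_
  rw [idem_eq_single]
  change ((h.shift x : h.Alg) * single h.system ⊥ (sink P) _).val ⊥ k =
    ((x : h.Alg) * single h.system (sink P) (sink P) _).val ⊥ k
  by_cases hk : k = sink P
  · subst hk
    rw [val_mul_single, val_mul_single]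
    refine congr_arg (· * ε ⊤) (val_single_same _)
  · rw [val_mul_apply, val_mul_apply]
    refine Finset.sum_congr rfl fun l _ => ?_
    rw [val_single _ l, val_single _ l, if_neg fun h => hk h.2, if_neg fun h => hk h.2, mul_zero,
      mul_zero]

/-- The shift on a direct sum of copies of `e_0 Λ`. -/
noncomputable def shiftSum (ν : Type u) : (ν →₀ h.E₀) →+ (ν →₀ h.E₀) :=
  Finsupp.mapRange.addMonoidHom h.shift

variable {ν : Type u}

theorem shiftSum_smul (x : ν →₀ h.E₀) (d : h.system.space (sink P) (sink P)) :
    h.shiftSum ν (op (single h.system _ _ d) • x) =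
      op (single h.system ⊥ ⊥ ⟨d, h.space_sink_sink.le d.2⟩) • h.shiftSum ν x :=
  Finsupp.ext fun k => h.shift_smul (x k) d

theorem smul_shiftSum (x : ν →₀ h.E₀) :
    op (single h.system ⊥ (sink P) ⟨ε ⊤, h.mem_space_sink.2 ⟨h.idem_top, h.idem_top⟩⟩) •
      h.shiftSum ν x = op (idem h.system (sink P)) • x :=
  Finsupp.ext fun k => h.smul_shift (x k)

/-- The element `b_k x a_l` of `ε_𝔪 A ε_𝔪`. -/
def mid {i j : WithBot (WithTop P)} (x : h.system.space i j) (k l : Fin F.n) :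
    h.system.space (sink P) (sink P) :=
  ⟨F.b k * x * F.a l, h.mem_space_sink.2 ⟨by
    change ε ⊤ * _ = _
    rw [← mul_assoc, ← mul_assoc, F.mul_b], by rw [mul_assoc, F.a_mul]⟩⟩

/-- Inserting `∑ a_k b_k = 1` gives `x a_l = ∑ a_k (b_k x a_l)`. The same coefficients `b_k x a_l`
appear in `fromBot_mul_single`, and this match makes `extMap` linear. -/
theorem single_mul_toSink {i j : WithBot (WithTop P)} (x : h.system.space i j) (l : Fin F.n) :
    single h.system i j x * single h.system j (sink P) (h.toSink F j l) =
      ∑ k, single h.system i (sink P) (h.toSink F i k) *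
        single h.system (sink P) (sink P) (h.mid F x k l) := by
  simp only [single_mul_single]
  rw [← map_sum]
  refine congr_arg _ (Subtype.ext ?_)
  simp only [AddSubmonoidClass.coe_finsetSum, toSink, mid]
  rw [← mul_assoc, h.mul_one_mem]
  simp only [mul_assoc (F.b _)]
  rw [F.mul_left_sum, ← mul_assoc, h.one_mul_mem]

theorem fromBot_mul_single {i j : WithBot (WithTop P)} (x : h.system.space i j) (k : Fin F.n) :
    single h.system ⊥ i (h.fromBot F i k) * single h.system i j x =
      ∑ l, single h.system ⊥ ⊥ ⟨h.mid F x k l, h.space_sink_sink.le (h.mid F x k l).2⟩ *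
        single h.system ⊥ j (h.fromBot F j l) := by
  simp only [single_mul_single]
  rw [← map_sum]
  refine congr_arg _ (Subtype.ext ?_)
  simp only [AddSubmonoidClass.coe_finsetSum, fromBot, mid]
  rw [F.mul_left_sum, mul_assoc, mul_assoc, h.one_mul_mem, h.mul_one_mem]

section Extension

variable {Y : Type u} [AddCommGroup Y] [Module h.Algᵐᵒᵖ Y] {φ : Y →+ (ν →₀ h.E₀)}

/-- The extension of an additive map to `(e_0 Λ)^(ν)`. -/
noncomputable def extMap (φ : Y →+ (ν →₀ h.E₀)) : Y →+ (ν →₀ h.E₀) where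
  -- Modelled on `y = ∑ y a_k b_k`: multiplication by `ε_i a_k` moves `y` to `𝔪`, where `φ` applies;
  -- the value is shifted to `0`, and `b_k ε_i` carries it back to `i`.
  toFun y := ∑ i, ∑ k, op (single h.system ⊥ i (h.fromBot F i k)) •
    h.shiftSum ν (φ (op (single h.system i (sink P) (h.toSink F i k)) • y))
  map_zero' := by simp
  map_add' x y := by simp [Finset.sum_add_distrib]

theorem extMap_single_smul (hφ : ∀ (d : h.system.space (sink P) (sink P)) (y : Y),
      φ (op (single h.system _ _ d) • y) = op (single h.system _ _ d) • φ y)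
    {i j : WithBot (WithTop P)} (x : h.system.space i j) (y : Y) :
    h.extMap F φ (op (single h.system i j x) • y) =
      op (single h.system i j x) • h.extMap F φ y := by
  change ∑ _, ∑ _, _ = _ • ∑ _, ∑ _, _
  rw [Finset.sum_eq_single j, Finset.smul_sum, Finset.sum_eq_single i]
  · have h1 : ∀ l, h.shiftSum ν (φ (op (single h.system j (sink P) (h.toSink F j l)) •
        op (single h.system i j x) • y)) = ∑ k,
        op (single h.system ⊥ ⊥ ⟨h.mid F x k l, h.space_sink_sink.le (h.mid F x k l).2⟩) •
          h.shiftSum ν (φ (op (single h.system i (sink P) (h.toSink F i k)) • y)) := fun l => by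
      rw [smul_smul, ← op_mul, single_mul_toSink, Finset.op_sum, Finset.sum_smul, map_sum, map_sum]
      refine Finset.sum_congr rfl fun k _ => ?_
      rw [op_mul, mul_smul, hφ, shiftSum_smul]
    simp only [h1, Finset.smul_sum]
    rw [Finset.sum_comm]
    refine Finset.sum_congr rfl fun k _ => ?_
    rw [smul_smul (op (single h.system i j x)), ← op_mul, fromBot_mul_single, Finset.op_sum,
      Finset.sum_smul]
    exact Finset.sum_congr rfl fun l _ => by rw [smul_smul, ← op_mul]
  · intro l _ hl
    rw [Finset.smul_sum]
    refine Finset.sum_eq_zero fun k _ => ?_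
    rw [smul_smul, ← op_mul, single_mul_single_of_ne hl, op_zero, zero_smul]
  · simp
  · intro l _ hl
    refine Finset.sum_eq_zero fun k _ => ?_
    rw [smul_smul (op (single h.system l _ _)), ← op_mul, single_mul_single_of_ne hl.symm, op_zero,
      zero_smul, map_zero, map_zero, smul_zero]
  · simp

theorem extMap_smul (hφ : ∀ (d : h.system.space (sink P) (sink P)) (y : Y),
      φ (op (single h.system _ _ d) • y) = op (single h.system _ _ d) • φ y)
    (c : h.Algᵐᵒᵖ) (y : Y) : h.extMap F φ (c • y) = c • h.extMap F φ y := by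
  rw [← op_unop c, ← sum_single (unop c), Finset.op_sum, Finset.sum_smul, Finset.sum_smul, map_sum]
  refine Finset.sum_congr rfl fun i _ => ?_
  rw [Finset.op_sum, Finset.sum_smul, Finset.sum_smul, map_sum]
  exact Finset.sum_congr rfl fun j _ => h.extMap_single_smul F hφ _ y

/-- Only the summand at `𝔪` survives; it collapses by `∑ a_k b_k = 1`, and multiplication from `0`
to `𝔪` undoes the shift. -/
theorem extMap_apply_of_fixed (hφ : ∀ (d : h.system.space (sink P) (sink P)) (y : Y),
      φ (op (single h.system _ _ d) • y) = op (single h.system _ _ d) • φ y) {y : Y}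
    (hy : op (idem h.system (sink P)) • y = y) : h.extMap F φ y = φ y := by
  have hone : ∀ z : Y, op (idem h.system (sink P)) • z = z →
      op (idem h.system (sink P)) • φ z = φ z := fun z hz => by
    rw [idem_eq_single, ← hφ, ← idem_eq_single, hz]
  change ∑ _, ∑ _, _ = _
  rw [Finset.sum_eq_single (sink P)]
  · have h1 : ∀ k, op (single h.system ⊥ (sink P) (h.fromBot F (sink P) k)) •
        h.shiftSum ν (φ (op (single h.system (sink P) (sink P) (h.toSink F (sink P) k)) • y)) =
        op (single h.system ⊥ (sink P) ⟨h.toSink F (sink P) k * h.fromBot F (sink P) k,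
          h.system.mul_mem' _ ⊥ _ (h.space_sink_sink.le (h.toSink F (sink P) k).2)
            (h.fromBot F (sink P) k).2⟩) • h.shiftSum ν (φ y) := fun k => by
      rw [hφ, shiftSum_smul, smul_smul, ← op_mul, single_mul_single]
    simp only [h1]
    rw [← Finset.sum_smul, ← Finset.op_sum, ← map_sum]
    conv_rhs => rw [← hone y hy, ← smul_shiftSum]
    congr 3
    refine Subtype.ext ?_
    simp only [AddSubmonoidClass.coe_finsetSum, fromBot, toSink]
    rw [F.mul_left_sum]
    exact h.idem_top
  · intro i _ hi
    refine Finset.sum_eq_zero fun k _ => ?_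
    rw [← hy, smul_smul (op (single h.system i _ _)), ← op_mul, idem_eq_single,
      single_mul_single_of_ne hi.symm, op_zero, zero_smul, map_zero, map_zero, smul_zero]
  · simp

include F in
theorem exists_linearMap_extending (N : Submodule h.Algᵐᵒᵖ Y)
    (hN : ∀ y, y ∈ N ↔ op (idem h.system (sink P)) • y = y) (φ : N →ₗ[h.Algᵐᵒᵖ] (ν →₀ h.E₀)) :
    ∃ g : Y →ₗ[h.Algᵐᵒᵖ] (ν →₀ h.E₀), ∀ y : N, g y = φ y := by
  have hmem : ∀ y : Y, op (idem h.system (sink P)) • y ∈ N := fun y => by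
    rw [hN, smul_smul, ← op_mul, idem_mul_idem]
  let φ' : Y →+ (ν →₀ h.E₀) :=
    { toFun := fun y => φ ⟨_, hmem y⟩
      map_zero' := by
        rw [← map_zero φ]
        exact congr_arg φ (Subtype.ext (smul_zero _))
      map_add' := fun x y => by
        rw [← map_add φ]
        exact congr_arg φ (Subtype.ext (smul_add _ _ _)) }
  have hφ' : ∀ (d : h.system.space (sink P) (sink P)) (y : Y),
      φ' (op (single h.system _ _ d) • y) = op (single h.system _ _ d) • φ' y := fun d y => by
    refine Eq.trans (congr_arg φ (Subtype.ext ?_)) (map_smul φ _ _)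
    change op (idem h.system (sink P)) • _ • y = _ • op (idem h.system (sink P)) • y
    rw [smul_smul, smul_smul, ← op_mul, ← op_mul, single_mul_idem, idem_mul_single]
  refine ⟨{ h.extMap F φ' with map_smul' := h.extMap_smul F hφ' }, fun y => ?_⟩
  have hy := (hN y).1 y.2
  exact (h.extMap_apply_of_fixed F hφ' hy).trans (congr_arg φ (Subtype.ext hy))

end Extension

theorem finiteDimensional_alg [FiniteDimensional K A] : Module.Finite K h.Alg :=
  inferInstanceAs (Module.Finite K h.system.matrices)

/-- In the dual order `𝔪` is least and `0` greatest. The conditions on the ring all reduce to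
entries: fullness of `ε_𝔪` supplies nonzero ones, and the division ring `ε_𝔪 A ε_𝔪` supplies
inverses. -/
theorem socleFrame [FiniteDimensional K A] :
    SocleFrame (fun i : (WithBot (WithTop P))ᵒᵈ => op (idem h.system (OrderDual.ofDual i)))
      (OrderDual.toDual (sink P)) (OrderDual.toDual ⊥)
      (⟨idem h.system ⊥, h.idem_bot_mem⟩ : h.E₀) := by
  obtain ⟨F⟩ := h.nonempty_fullIdempotent
  have := h.finiteDimensional_alg
  refine { triangularIdempotents_op h.system_exists_inv with
    least := fun i => ?_
    greatest := fun i => ?_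
    artinian := IsArtinianRing.of_finite K _
    detected := ?_
    exists_ne_zero := ?_
    exists_mul_eq := ?_
    smul_q := Subtype.ext (idem_mul_idem _)
    span_q := ?_
    mul_eq_zero := ?_
    exists_extension := fun ν Y _ _ N hN φ => h.exists_linearMap_extending F N hN φ }
  · change OrderDual.ofDual i ≤ sink P
    rw [sink, WithBot.coe_top]
    exact le_top
  · change ⊥ ≤ OrderDual.ofDual i
    exact bot_le
  · intro z hz
    have : ∃ i j, (unop z).val i j ≠ 0 := by
      by_contra! h0
      exact hz (unop_injective (ext' h0))
    obtain ⟨i, j, hij⟩ := this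
    obtain ⟨k, hk⟩ := h.exists_mul_toSink_ne_zero F (x := ⟨_, (unop z).val_mem i j⟩)
      fun h0 => hij (congr_arg Subtype.val h0)
    refine ⟨op (single h.system j (sink P) (h.toSink F j k)), fun h0 => hk ?_⟩
    have h1 : unop z * single h.system j (sink P) (h.toSink F j k) = 0 := by
      have := congr_arg unop h0
      rw [smul_smul] at this
      change unop z * (_ * _) = 0 at this
      rwa [unop_op, unop_op, OrderDual.ofDual_toDual, single_mul_idem] at this
    have h2 := h.val_mul_single (k := i) (unop z) (h.toSink F j k)
    rw [h1] at h2
    exact h2.symm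
  · intro j
    have hx : (⟨h.system.one (OrderDual.ofDual j), h.system.one_mem _⟩ :
        h.system.space _ _) ≠ 0 := fun h0 => h.system_one_ne_zero _ (congr_arg Subtype.val h0)
    have : ∃ k, (h.fromBot F (OrderDual.ofDual j) k : A) ≠ 0 := by
      by_contra! h0
      refine h.system_one_ne_zero (OrderDual.ofDual j) ?_
      change botIdem ε _ = 0
      rw [← h.botIdem_mul_self, ← F.mul_left_sum]
      refine Finset.sum_eq_zero fun k _ => ?_
      exact (congr_arg (_ * ·) (h0 k)).trans (mul_zero _)
    obtain ⟨k, hk⟩ := this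
    refine ⟨op (single h.system ⊥ _ (h.fromBot F (OrderDual.ofDual j) k)), fun h0 => hk ?_⟩
    have h1 := congr_arg unop h0
    change idem h.system ⊥ * (_ * _) = 0 at h1
    rw [unop_op, unop_op, single_mul_idem, idem_mul_single, ← map_zero (single h.system ⊥ (OrderDual.ofDual j))] at h1
    exact congr_arg Subtype.val (single_injective _ _ h1)
  · intro b b' hb
    have key : ∀ b : h.Algᵐᵒᵖ, op (idem h.system (sink P)) * b * op (idem h.system ⊥) =
        op (single h.system ⊥ (sink P) ⟨_, (unop b).val_mem ⊥ (sink P)⟩) := fun b => by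
      rw [← idem_mul_mul_idem, mul_assoc (idem _ _)]
      rfl
    change op (idem h.system (sink P)) * b * op (idem h.system ⊥) ≠ 0 at hb
    change ∃ c, c * (op (idem h.system (sink P)) * b * op (idem h.system ⊥)) =
      op (idem h.system (sink P)) * b' * op (idem h.system ⊥)
    rw [key] at hb ⊢
    rw [key]
    have hx0 : (unop b).val ⊥ (sink P) ≠ 0 := fun h0 => hb (by
      rw [show (⟨_, (unop b).val_mem ⊥ (sink P)⟩ : h.system.space _ _) = 0 from Subtype.ext h0,
        map_zero, op_zero])
    obtain ⟨y, hy, hxy, -⟩ := h.system_exists_inv ⊥ ((unop b).val ⊥ (sink P))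
      (h.space_bot_sink.le ((unop b).val_mem ⊥ (sink P))) hx0
    -- The entry of `b` at `(0, 𝔪)` is invertible with inverse `y`, so multiplying it on the right
    -- by `y` times the entry of `b'` yields the latter.
    refine ⟨op (single h.system (sink P) (sink P) ⟨y * (unop b').val ⊥ (sink P), ?_⟩), ?_⟩
    · exact h.system.mul_mem' _ (sink P) _ (h.space_sink_sink.ge hy)
        ((h.space_sink_sink.trans h.space_bot_sink.symm).ge ((unop b').val_mem ⊥ (sink P)))
    · rw [← op_mul, single_mul_single]
      refine congr_arg _ (congr_arg _ (Subtype.ext ?_))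
      change _ * (y * _) = _
      rw [← mul_assoc, hxy]
      exact h.system.one_mul' ⊥ _ ((unop b').val_mem ⊥ (sink P))
  · rw [eq_top_iff]
    rintro ⟨x, hx⟩ -
    refine Submodule.mem_span_singleton.2 ⟨op x, Subtype.ext ?_⟩
    exact h.mem_E₀.1 hx
  · intro b hb
    have : idem h.system ⊥ * unop b = 0 := congr_arg Subtype.val hb
    exact unop_injective this

end MultSystem.IsExtendable

/-! ### Counting simple modules: every `ε_i` is full in `T_i`. -/

/-- Pigeonhole: there are at most `|ι|` classes of simple `B₁`-modules, and an equivalence carries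
simples to simples and reflects isomorphism. -/
theorem TriangularIdempotents.exists_iso_of_equivalence {B₁ B₂ ι : Type u} [Ring B₁] [Ring B₂]
    [Fintype ι] [PartialOrder ι] {e : ι → B₁} (he : TriangularIdempotents e)
    (C : ModuleCat.{u} B₁ ≌ ModuleCat.{u} B₂) (S : Option ι → ModuleCat.{u} B₂)
    [∀ x, Simple (S x)] : ∃ x y, x ≠ y ∧ Nonempty (S x ≅ S y) := by
  have hs : ∀ x, Simple (C.inverse.obj (S x)) := fun x => simple_obj C.inverse (S x)
  choose t ht using fun x => he.exists_actsAsOne (X := C.inverse.obj (S x))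
  obtain ⟨x, y, hxy, hne⟩ := Fintype.exists_ne_map_eq_of_card_lt t (by simp)
  obtain ⟨E⟩ := he.nonempty_linearEquiv (ht x) (hne ▸ ht y)
  exact ⟨x, y, hxy, ⟨C.inverse.preimageIso E.toModuleIso⟩⟩

namespace MultSystem

variable {K A P : Type u} [Field K] [Ring A] [Algebra K A] [PartialOrder P] [Fintype P]

open IncAlg

theorem IncAlg.val_mul_diag (U : MultSystem K A P) (a b : U.IncAlg) (i : P) :
    (a * b).val i i = a.val i i * b.val i i := by
  rw [val_mul_apply]
  refine Finset.sum_eq_single i (fun j _ hj => ?_) (by simp)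
  by_cases h1 : i ≤ j
  · have h2 : ¬ j ≤ i := fun h2 => hj (le_antisymm h2 h1)
    have := b.val_mem j i
    rw [U.space_eq_bot j i h2, Submodule.mem_bot] at this
    rw [this, mul_zero]
  · have := a.val_mem i j
    rw [U.space_eq_bot i j h1, Submodule.mem_bot] at this
    rw [this, zero_mul]

/-- A proper left ideal lies in a maximal one, and the quotient by the latter is simple. -/
theorem exists_simple_quotient {B : Type u} [Ring B] {I : Ideal B} (hI : (1 : B) ∉ I) :
    ∃ m : Ideal B, I ≤ m ∧ IsSimpleModule B (B ⧸ m) ∧ (1 : B) ∉ m := by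
  obtain ⟨m, hm, hle⟩ := Ideal.exists_le_maximal I ((Ideal.ne_top_iff_one I).2 hI)
  exact ⟨m, hle, isSimpleModule_iff_isCoatom.2 hm.out, (Ideal.ne_top_iff_one m).1 hm.ne_top⟩

/-- The elements of the incidence algebra with `(i, i)` entry in a left ideal of `U i i`. -/
def diagIdeal (U : MultSystem K A P) (i : P) (I : Submodule K A)
    (hI : ∀ a ∈ U.space i i, ∀ x ∈ I, a * x ∈ I) : Ideal U.IncAlg where
  carrier := {a | a.val i i ∈ I}
  add_mem' ha hb := I.add_mem ha hb
  zero_mem' := I.zero_mem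
  smul_mem' a x hx := by
    rw [Set.mem_ofPred_eq, smul_eq_mul, val_mul_diag]
    exact hI _ (a.val_mem i i) _ hx

variable {U : MultSystem K A P} {ε : P → A} (hε : U.IsIdemFamily ε)

/-- The idempotent of the incidence algebra with entry `ε i` at `(i, i)`. -/
noncomputable def diagIdem (i : P) : U.IncAlg := single U i i ⟨ε i, hε.mem i⟩

/-- A simple module over `U i i` is a simple `Λ(U)`-module through the diagonal entry at `i`, where
the other idempotents act by zero. The maximal left ideal is chosen to contain `1 - ε i`, so it
cannot contain `ε i`. -/
theorem exists_simple_diagIdem_ne_zero (i : P) (hi : ε i ≠ 0) :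
    ∃ S : ModuleCat.{u} U.IncAlg, Simple S ∧ (∃ x : S, diagIdem hε i • x ≠ 0) ∧
      ∀ j, j ≠ i → ∀ x : S, diagIdem hε j • x = 0 := by
  classical
  let I : Submodule K A :=
    { carrier := {x | x * ε i = 0}
      add_mem' := fun {x y} (hx : _ = _) (hy : _ = _) => by
        rw [Set.mem_ofPred_eq, add_mul, hx, hy, add_zero]
      zero_mem' := zero_mul _
      smul_mem' := fun c x (hx : _ = _) => by
        rw [Set.mem_ofPred_eq, smul_mul_assoc, hx, smul_zero] }
  have hI : ∀ a ∈ U.space i i, ∀ x ∈ I, a * x ∈ I := fun a _ x (hx : _ = _) => by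
    change a * x * ε i = 0
    rw [mul_assoc, hx, mul_zero]
  have hd : ∀ j, (diagIdem hε j).val i i = if i = j then ε j else 0 := fun j => by
    rw [diagIdem, val_single]
    simp
  obtain ⟨m, hle, hm, h1⟩ := exists_simple_quotient (I := diagIdeal U i I hI) (by
    change ¬ ((1 : U.IncAlg).val i i * ε i = 0)
    rw [val_one, if_pos rfl, U.one_mul' i i (hε.mem i)]
    exact hi)
  refine ⟨ModuleCat.of _ (U.IncAlg ⧸ m), inferInstance, ⟨m.mkQ 1, ?_⟩, fun j hj x => ?_⟩
  · change diagIdem hε i • m.mkQ 1 ≠ 0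
    rw [← map_smul, Submodule.mkQ_apply, Ne, Submodule.Quotient.mk_eq_zero, smul_eq_mul, _root_.mul_one]
    intro h2
    refine h1 ?_
    have h3 : 1 - diagIdem hε i ∈ m := hle (by
      have : (1 - diagIdem hε i).val i i = U.one i - ε i := by
        rw [← hd i |>.trans (if_pos rfl)]
        change (1 : U.IncAlg).val i i - _ = _
        rw [val_one, if_pos rfl]
        rfl
      change (1 - diagIdem hε i).val i i * ε i = 0
      rw [this, sub_mul, U.one_mul' i i (hε.mem i), hε.idem, sub_self])
    simpa using m.add_mem h3 h2
  · obtain ⟨x, rfl⟩ := m.mkQ_surjective x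
    change diagIdem hε j • m.mkQ x = 0
    rw [← map_smul, Submodule.mkQ_apply, Submodule.Quotient.mk_eq_zero]
    refine hle ?_
    change (diagIdem hε j * x).val i i * ε i = 0
    rw [val_mul_diag, hd, if_neg hj.symm, zero_mul, zero_mul]

/-- A maximal left ideal above the proper ideal `(U i i) ε_i (U i i)` gives a simple module at `i`
that `ε i` annihilates as well. -/
theorem exists_simple_diagIdem_eq_zero {i : P}
    (hi : U.one i ∉ Submodule.span K {z | ∃ a ∈ U.space i i, ∃ b ∈ U.space i i, a * ε i * b = z}) :
    ∃ S : ModuleCat.{u} U.IncAlg, Simple S ∧ ∀ j, ∀ x : S, diagIdem hε j • x = 0 := by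
  classical
  set I := Submodule.span K {z | ∃ a ∈ U.space i i, ∃ b ∈ U.space i i, a * ε i * b = z} with hIdef
  have hI : ∀ a ∈ U.space i i, ∀ x ∈ I, a * x ∈ I := fun a ha x hx => by
    induction hx using Submodule.span_induction with
    | mem x hx =>
      obtain ⟨b, hb, c, hc, rfl⟩ := hx
      exact Submodule.subset_span ⟨a * b, U.mul_mem' _ _ _ ha hb, c, hc, by simp only [mul_assoc]⟩
    | zero => rw [mul_zero]; exact zero_mem _
    | add x y _ _ hx hy => rw [mul_add]; exact add_mem hx hy
    | smul c x _ hx => rw [mul_smul_comm]; exact Submodule.smul_mem _ c hx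
  obtain ⟨m, hle, hm, h1⟩ := exists_simple_quotient (I := diagIdeal U i I hI) (by
    change ¬ ((1 : U.IncAlg).val i i ∈ I)
    rwa [val_one, if_pos rfl])
  refine ⟨ModuleCat.of _ (U.IncAlg ⧸ m), inferInstance, fun j x => ?_⟩
  obtain ⟨x, rfl⟩ := m.mkQ_surjective x
  change diagIdem hε j • m.mkQ x = 0
  rw [← map_smul, Submodule.mkQ_apply, Submodule.Quotient.mk_eq_zero]
  refine hle ?_
  change (diagIdem hε j * x).val i i ∈ I
  rw [val_mul_diag, diagIdem, val_single]
  split_ifs with hj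
  · obtain ⟨rfl, -⟩ := hj
    exact Submodule.subset_span ⟨U.one i, U.one_mem i, _, x.val_mem i i, by
      rw [U.one_mul' i i (hε.mem i)]⟩
  · rw [zero_mul]; exact I.zero_mem

/-- If `Λ(R)` for the system `R i j = ε_i (U i j) ε_j` with division rings `R i i` is Morita
equivalent to `Λ(U)`, then every `ε i` is a full idempotent of `U i i`. -/
theorem one_mem_span_of_equivalence
    (hR : ∀ i, ∀ x ∈ (U.corner ε hε).space i i, x ≠ 0 →
      ∃ y ∈ (U.corner ε hε).space i i, x * y = ε i ∧ y * x = ε i)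
    (hne : ∀ i, ε i ≠ 0) (C : ModuleCat.{u} (U.corner ε hε).IncAlg ≌ ModuleCat.{u} U.IncAlg) (i : P) :
    U.one i ∈ Submodule.span K {z | ∃ a ∈ U.space i i, ∃ b ∈ U.space i i, a * ε i * b = z} := by
  by_contra hi
  -- If `ε i` is not full, `S₀` and the `S j` are `|P| + 1` pairwise nonisomorphic simples: `ε j`
  -- acts nontrivially on `S j` alone.
  obtain ⟨S₀, h₀, hS₀⟩ := exists_simple_diagIdem_eq_zero hε hi
  choose S hS hS1 hS2 using fun j => exists_simple_diagIdem_ne_zero hε j (hne j)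
  have hiso : ∀ {X Y : ModuleCat.{u} U.IncAlg} (_ : X ≅ Y) (j : P),
      (∀ x : X, diagIdem hε j • x = 0) → ∀ y : Y, diagIdem hε j • y = 0 := fun {X Y} E j hX y => by
    have h1 := congr_arg E.hom.hom (hX (E.inv.hom y))
    rw [map_smul, map_zero] at h1
    have h2 : E.hom.hom (E.inv.hom y) = y := by
      rw [← ModuleCat.comp_apply, E.inv_hom_id]
      rfl
    rwa [h2] at h1
  have : ∀ x : Option P, Simple ((fun x : Option P => x.elim S₀ S) x) := fun x => by
    cases x
    · exact h₀
    · exact hS _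
  obtain ⟨x, y, hxy, ⟨E⟩⟩ := (triangularIdempotents hR).exists_iso_of_equivalence C
    (fun x : Option P => x.elim S₀ S)
  cases x with
  | none =>
    cases y with
    | none => exact hxy rfl
    | some j =>
      obtain ⟨x, hx⟩ := hS1 j
      exact hx (hiso E j (hS₀ j) x)
  | some k =>
    obtain ⟨x, hx⟩ := hS1 k
    cases y with
    | none => exact hx (hiso E.symm k (hS₀ k) x)
    | some j => exact hx (hiso E.symm k (hS2 j k fun h => hxy (h ▸ rfl)) x)

theorem IsExtendable.one_mem_span {T : MultSystem K A P} {ε : WithTop P → A} (h : T.IsExtendable ε)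
    (i : P) : (1 : A) ∈ Submodule.span K
      {z | ∃ a ∈ T.space i i, ∃ b ∈ T.space i i, a * ε i * b = z} := by
  obtain ⟨⟨C, _⟩⟩ := h.morita
  exact one_mem_span_of_equivalence h.idemFamily h.admissible.exists_inv h.admissible.one_ne_zero C i

end MultSystem

/-! ### The functor from representations to modules is fully faithful. -/

namespace MultSystem.IsExtendable

open IncAlg MulOpposite

variable {K A P : Type u} [Field K] [Ring A] [Algebra K A] [PartialOrder P] [Fintype P]
  {T : MultSystem K A P} {ε : WithTop P → A} (h : T.IsExtendable ε)

section RepModule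

variable (X Y : T.Rep)

/-- The subgroups `L_i` of a representation, with `0` at the smallest and `L` at the largest element
of the extended poset. -/
def repPart : WithBot (WithTop P) → AddSubgroup X.L :=
  WithBot.recBotCoe ⊥ (WithTop.recTopCoe ⊤ X.sub)

variable {X Y} in
include h in
theorem repPart_smul {i j : WithBot (WithTop P)} (r : h.system.space i j) {x : X.L}
    (hx : x ∈ repPart X i) : op (r : A) • x ∈ repPart X j := by
  by_cases hij : i ≤ j
  · have hr := (mem_corner.1 r.2).1
    induction i using WithBot.recBotCoe with
    | bot =>
      rw [(AddSubgroup.mem_bot.1 hx : x = 0), smul_zero]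
      exact zero_mem _
    | coe i =>
      induction j using WithBot.recBotCoe with
      | bot => exact absurd hij (WithBot.not_coe_le_bot i)
      | coe j =>
        induction j using WithTop.recTopCoe with
        | top => trivial
        | coe j =>
          induction i using WithTop.recTopCoe with
          | top => exact absurd (WithBot.coe_le_coe.1 hij) (WithTop.not_top_le_coe j)
          | coe i =>
            exact X.mul_mem i j (WithTop.coe_le_coe.1 (WithBot.coe_le_coe.1 hij)) x hx r hr
  · have hr : (r : A) = 0 := (Submodule.mem_bot K).1 ((h.system.space_eq_bot i j hij).le r.2)
    rw [hr, op_zero, zero_smul]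
    exact zero_mem _

omit [Fintype P] in
theorem mem_repPart_sink {X : T.Rep} (z : X.L) : z ∈ repPart X (sink P) := trivial

/-- The row vectors with entries in `L_i ε_i`. -/
def rows : AddSubgroup (WithBot (WithTop P) → X.L) where
  carrier := {x | ∀ i, x i ∈ repPart X i ∧ op (botIdem ε i) • x i = x i}
  add_mem' {x y} hx hy i := ⟨add_mem (hx i).1 (hy i).1, by
    rw [Pi.add_apply, smul_add, (hx i).2, (hy i).2]⟩
  zero_mem' i := ⟨zero_mem _, smul_zero _⟩
  neg_mem' {x} hx i := ⟨neg_mem (hx i).1, by rw [Pi.neg_apply, smul_neg, (hx i).2]⟩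

/-- The `Λ`-module of a representation. -/
def RepMod (_ : T.IsExtendable ε) : Type u := rows (ε := ε) X

instance : AddCommGroup (h.RepMod X) := inferInstanceAs (AddCommGroup (rows (ε := ε) X))

variable {X Y}

/-- The entries of an element of the module of a representation. -/
def RepMod.entry {h : T.IsExtendable ε} (i : WithBot (WithTop P)) : h.RepMod X →+ X.L where
  toFun x := x.1 i
  map_zero' := rfl
  map_add' _ _ := rfl

theorem RepMod.ext {x y : h.RepMod X} (hxy : ∀ i, entry i x = entry i y) : x = y :=
  Subtype.ext (funext hxy)

theorem RepMod.entry_mem (x : h.RepMod X) (i : WithBot (WithTop P)) :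
    entry i x ∈ repPart X i := (x.2 i).1

theorem RepMod.smul_entry (x : h.RepMod X) (i : WithBot (WithTop P)) :
    op (botIdem ε i) • entry i x = entry i x := (x.2 i).2

open RepMod

instance : SMul h.Algᵐᵒᵖ (h.RepMod X) :=
  ⟨fun c x => ⟨fun j => ∑ i, op ((unop c).val i j) • entry i x, fun j => ⟨sum_mem fun i _ =>
    h.repPart_smul ⟨_, (unop c).val_mem i j⟩ (entry_mem h x i), by
      rw [Finset.smul_sum]
      refine Finset.sum_congr rfl fun i _ => ?_
      rw [smul_smul, ← op_mul]
      exact congr_arg (op · • _) (h.system.mul_one' i j ((unop c).val_mem i j))⟩⟩⟩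

theorem entry_smul (c : h.Algᵐᵒᵖ) (x : h.RepMod X) (j : WithBot (WithTop P)) :
    entry j (c • x) = ∑ i, op ((unop c).val i j) • entry i x := rfl

noncomputable instance : Module h.Algᵐᵒᵖ (h.RepMod X) where
  one_smul x := RepMod.ext h fun j => by
    classical
    rw [entry_smul, Finset.sum_eq_single j]
    · rw [unop_one, val_one, if_pos rfl]
      exact smul_entry h x j
    · intro i _ hi
      rw [unop_one, val_one, if_neg hi, op_zero, zero_smul]
    · simp
  mul_smul a b x := RepMod.ext h fun j => by
    simp only [entry_smul, unop_mul, val_mul_apply, Finset.op_sum, Finset.sum_smul,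
      Finset.smul_sum, smul_smul, op_mul]
    exact Finset.sum_comm
  smul_zero c := RepMod.ext h fun j => by simp [entry_smul]
  smul_add c x y := RepMod.ext h fun j => by simp [entry_smul, Finset.sum_add_distrib]
  add_smul a b x := RepMod.ext h fun j => by
    simp [entry_smul, Finset.sum_add_distrib, val_add, add_smul]
  zero_smul x := RepMod.ext h fun j => by simp [entry_smul, val_zero]

theorem entry_single_smul {i j : WithBot (WithTop P)} (r : h.system.space i j) (x : h.RepMod X) :
    entry j (op (single h.system i j r) • x) = op (r : A) • entry i x := by
  classical
  rw [entry_smul, Finset.sum_eq_single i]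
  · rw [unop_op, val_single_same]
  · intro k _ hk
    rw [unop_op, val_single, if_neg fun h => hk h.1, op_zero, zero_smul]
  · simp

theorem entry_single_smul_of_ne {i j l : WithBot (WithTop P)} (hl : l ≠ j) (r : h.system.space i j)
    (x : h.RepMod X) : entry l (op (single h.system i j r) • x) = 0 := by
  classical
  rw [entry_smul]
  refine Finset.sum_eq_zero fun k _ => ?_
  rw [unop_op, val_single, if_neg fun h => hl h.2, op_zero, zero_smul]

omit [Fintype P] in
theorem sum_smul_smul (F : FullIdempotent (ε ⊤)) (z : X.L) :
    ∑ k, op (F.b k) • op (F.a k) • z = z := by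
  simp only [smul_smul, ← op_mul]
  rw [← Finset.sum_smul, ← Finset.op_sum, F.sum_eq_one, op_one, one_smul]

/-- For a nonzero entry `z = ∑ z a_k b_k` some `z a_k` is nonzero, and it is an entry at `𝔪`; this
gives detection. The source acts by zero because the entry at `0` vanishes. -/
theorem repMod_mem_U [FiniteDimensional K A] (X : T.Rep) :
    IsSocleProjective h.Algᵐᵒᵖ (h.RepMod X) ∧ ¬ HasSummand h.Algᵐᵒᵖ (h.RepMod X) h.E₀ := by
  refine h.socleFrame.mem_U_iff.2 ⟨fun x hx => ?_, fun x => ?_⟩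
  · obtain ⟨F⟩ := h.nonempty_fullIdempotent
    have : ∃ i, entry i x ≠ 0 := by
      by_contra! h0
      exact hx (RepMod.ext h fun i => (h0 i).trans (map_zero _).symm)
    obtain ⟨i, hi⟩ := this
    have : ∃ k, op (h.toSink F i k : A) • entry i x ≠ 0 := by
      by_contra! h0
      refine hi ?_
      rw [← sum_smul_smul F (entry i x)]
      refine Finset.sum_eq_zero fun k _ => ?_
      rw [← smul_entry h x i, smul_smul (op (F.a k)), ← op_mul]
      exact (congr_arg _ (h0 k)).trans (smul_zero _)
    obtain ⟨k, hk⟩ := this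
    refine ⟨op (single h.system i (sink P) (h.toSink F i k)), fun h0 => hk ?_⟩
    rw [smul_smul] at h0
    have h1 := congr_arg (entry (sink P)) h0
    rw [OrderDual.ofDual_toDual, ← op_mul, single_mul_idem, entry_single_smul, map_zero] at h1
    exact h1
  · refine RepMod.ext h fun j => ?_
    rw [map_zero, OrderDual.ofDual_toDual, idem_eq_single]
    by_cases hj : j = ⊥
    · subst hj
      have h0 : entry ⊥ x = 0 := AddSubgroup.mem_bot.1 (entry_mem h x ⊥)
      rw [entry_single_smul, h0, smul_zero]
    · exact h.entry_single_smul_of_ne hj _ x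

/-- The element of the module of a representation with the single entry `z` at `i`. -/
noncomputable def ofEntry (i : WithBot (WithTop P)) (z : X.L) (hz : z ∈ repPart X i)
    (hz' : op (botIdem ε i) • z = z) : h.RepMod X := by
  classical
  exact ⟨Pi.single i z, fun j => by
    by_cases hj : j = i
    · subst hj
      rw [Pi.single_eq_same]
      exact ⟨hz, hz'⟩
    · rw [Pi.single_eq_of_ne hj]
      exact ⟨zero_mem _, smul_zero _⟩⟩

theorem entry_ofEntry (i : WithBot (WithTop P)) (z : X.L) (hz : z ∈ repPart X i)
    (hz' : op (botIdem ε i) • z = z) : entry i (h.ofEntry i z hz hz') = z := by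
  classical
  exact Pi.single_eq_same (M := fun _ => X.L) i z

theorem entry_ofEntry_of_ne {i j : WithBot (WithTop P)} (hj : j ≠ i) (z : X.L)
    (hz : z ∈ repPart X i) (hz' : op (botIdem ε i) • z = z) :
    entry j (h.ofEntry i z hz hz') = 0 := by
  classical
  exact Pi.single_eq_of_ne (M := fun _ => X.L) hj z

omit [Fintype P] in
theorem mem_repPart_map (f : X ⟶ Y) {i : WithBot (WithTop P)} {z : X.L} (hz : z ∈ repPart X i) :
    f.hom z ∈ repPart Y i := by
  induction i using WithBot.recBotCoe with
  | bot =>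
    rw [(AddSubgroup.mem_bot.1 hz : z = 0), map_zero]
    exact zero_mem _
  | coe i =>
    induction i using WithTop.recTopCoe with
    | top => trivial
    | coe i => exact f.map_mem i z hz

/-- The homomorphism of `Λ`-modules of a morphism of representations. -/
def repMap (f : X ⟶ Y) : h.RepMod X →ₗ[h.Algᵐᵒᵖ] h.RepMod Y where
  toFun x := ⟨fun i => f.hom (entry i x), fun i => ⟨mem_repPart_map f (entry_mem h x i), by
    rw [← map_smul, smul_entry]⟩⟩
  map_add' x y := RepMod.ext h fun i => map_add f.hom _ _
  map_smul' c x := RepMod.ext h fun j => by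
    change f.hom (entry j (c • x)) = ∑ i, op ((unop c).val i j) • f.hom (entry i x)
    rw [entry_smul, map_sum]
    exact Finset.sum_congr rfl fun i _ => map_smul _ _ _

theorem entry_repMap (f : X ⟶ Y) (x : h.RepMod X) (i : WithBot (WithTop P)) :
    entry i (h.repMap f x) = f.hom (entry i x) := rfl

/-- The functor from representations to socle-projective modules. -/
noncomputable def repFunctor [FiniteDimensional K A] : T.Rep ⥤ CatU h.Algᵐᵒᵖ h.E₀ where
  obj X := ⟨ModuleCat.of _ (h.RepMod X), h.repMod_mem_U X⟩
  map f := ObjectProperty.homMk (ModuleCat.ofHom (h.repMap f))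
  map_id _ := rfl
  map_comp _ _ := rfl

section Full

variable (g : h.RepMod X →ₗ[h.Algᵐᵒᵖ] h.RepMod Y)

/-- The part at `𝔪` of a homomorphism of modules of representations. -/
noncomputable def sinkMap : X.L →+ Y.L where
  toFun z := entry (sink P) (g (h.ofEntry (sink P) (op (ε ⊤) • z) (mem_repPart_sink _) (by
    change op (ε ⊤) • _ = _
    rw [smul_smul, ← op_mul, h.idem_top])))
  map_zero' := by
    have : h.ofEntry (X := X) (sink P) (op (ε ⊤) • 0) (mem_repPart_sink _) (by simp) = 0 :=
      RepMod.ext h fun i => by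
        by_cases hi : i = sink P
        · subst hi
          rw [entry_ofEntry, smul_zero, map_zero]
        · rw [h.entry_ofEntry_of_ne hi, map_zero]
    rw [this, map_zero, map_zero]
  map_add' z w := by
    rw [← map_add, ← map_add]
    refine congr_arg _ (congr_arg _ (RepMod.ext h fun i => ?_))
    by_cases hi : i = sink P
    · subst hi
      rw [map_add, entry_ofEntry, entry_ofEntry, entry_ofEntry, smul_add]
    · rw [map_add, h.entry_ofEntry_of_ne hi, h.entry_ofEntry_of_ne hi, h.entry_ofEntry_of_ne hi,
        add_zero]

theorem sinkMap_smul_entry {i : WithBot (WithTop P)} (r : h.system.space i (sink P))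
    (x : h.RepMod X) :
    h.sinkMap g (op (r : A) • entry i x) = op (r : A) • entry i (g x) := by
  rw [← entry_single_smul, ← entry_single_smul, ← map_smul]
  change entry (sink P) (g (h.ofEntry (sink P) _ _ _)) = entry (sink P) (g _)
  refine congr_arg _ (congr_arg _ (RepMod.ext h fun j => ?_))
  by_cases hj : j = sink P
  · subst hj
    rw [entry_ofEntry]
    exact smul_entry h (op (single h.system i (sink P) r) • x) (sink P)
  · rw [h.entry_ofEntry_of_ne hj, h.entry_single_smul_of_ne hj]

theorem sinkMap_smul {d : A} (hd : ε ⊤ * d = d) (hd' : d * ε ⊤ = d) (z : X.L) :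
    h.sinkMap g (op d • z) = op d • h.sinkMap g z := by
  have hz : op (botIdem ε (sink P)) • op (ε ⊤) • z = op (ε ⊤) • z := by
    change op (ε ⊤) • _ = _
    rw [smul_smul, ← op_mul, h.idem_top]
  have h1 := h.sinkMap_smul_entry g ⟨d, h.mem_space_sink (i := sink P) |>.2 ⟨hd, hd'⟩⟩
    (h.ofEntry (sink P) (op (ε ⊤) • z) (mem_repPart_sink _) hz)
  rw [entry_ofEntry, smul_smul, ← op_mul, hd] at h1
  exact h1

variable (F : FullIdempotent (ε ⊤))

/-- The `A`-linear map induced by a homomorphism of modules of representations. -/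
noncomputable def preimageMap : X.L →ₗ[Aᵐᵒᵖ] Y.L where
  -- Forced by `z = ∑ z a_k b_k`: each `z a_k` lies in the part `L ε_𝔪` on which `g` is defined.
  toFun z := ∑ k, op (F.b k) • h.sinkMap g (op (F.a k) • z)
  map_add' z w := by simp [Finset.sum_add_distrib]
  map_smul' c z := by
    have h1 : ∀ k, h.sinkMap g (op (F.a k) • c • z) =
        ∑ l, op (F.b l * unop c * F.a k) • h.sinkMap g (op (F.a l) • z) := fun k => by
      rw [smul_smul, ← op_unop c, ← op_mul, ← _root_.one_mul (unop c * F.a k), ← F.sum_eq_one,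
        Finset.sum_mul, Finset.op_sum, Finset.sum_smul, map_sum]
      refine Finset.sum_congr rfl fun l _ => ?_
      rw [mul_assoc (F.a l), op_mul, mul_smul, sinkMap_smul]
      · simp only [unop_op, mul_assoc]
      · rw [← mul_assoc, F.mul_b]
      · rw [mul_assoc, mul_assoc, F.a_mul]
    simp only [h1, Finset.smul_sum, RingHom.id_apply]
    rw [Finset.sum_comm]
    refine Finset.sum_congr rfl fun l _ => ?_
    simp only [smul_smul, ← op_mul]
    rw [← Finset.sum_smul, ← Finset.op_sum]
    simp only [mul_assoc]
    rw [← Finset.mul_sum, ← Finset.mul_sum, F.sum_eq_one, _root_.mul_one, op_mul, op_unop]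

/-- Multiplication by `ε_i a_k` transports the entry at `i` to `𝔪` and commutes with `g`; summing
against `b_k` recovers it. -/
theorem preimageMap_entry (x : h.RepMod X) (i : WithBot (WithTop P)) :
    h.preimageMap g F (entry i x) = entry i (g x) := by
  have h1 : ∀ k, h.sinkMap g (op (F.a k) • entry i x) = op (h.toSink F i k : A) • entry i (g x) :=
    fun k => by
      rw [← sinkMap_smul_entry]
      conv_lhs => rw [← smul_entry h x i, smul_smul, ← op_mul]
      rfl
  change ∑ k, op (F.b k) • h.sinkMap g (op (F.a k) • entry i x) = _
  simp only [h1, toSink, op_mul, mul_smul, smul_entry]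
  exact sum_smul_smul F _

/-- Only `L_i ε_i` is visible to `g`. Writing `1` as a sum of `a ε_i b` with `a, b ∈ T_i`, each `z a
ε_i` is an entry at `i` and is sent into `Y_i`, and `b` keeps it there. -/
theorem preimageMap_mem (i : P) (z : X.L) (hz : z ∈ X.sub i) :
    h.preimageMap g F z ∈ Y.sub i := by
  have key : ∀ t ∈ Submodule.span K {z | ∃ a ∈ T.space i i, ∃ b ∈ T.space i i, a * ε i * b = z},
      h.preimageMap g F (op t • z) ∈ Y.sub i := fun t ht => by
    induction ht using Submodule.span_induction with
    | mem t ht =>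
      obtain ⟨a, ha, b, hb, rfl⟩ := ht
      have hw : op (ε i) • op a • z ∈ repPart X ((i : WithTop P) : WithBot (WithTop P)) :=
        X.mul_mem i i le_rfl _ (X.mul_mem i i le_rfl _ hz a ha) _ (h.idemFamily.mem i)
      have hw' : op (botIdem ε ((i : WithTop P) : WithBot (WithTop P))) • op (ε i) • op a • z =
          op (ε i) • op a • z := by
        rw [smul_smul, ← op_mul]
        exact congr_arg (op · • _) (h.idemFamily.idem i)
      have h1 := h.preimageMap_entry g F (h.ofEntry ((i : WithTop P) : WithBot (WithTop P)) _ hw hw')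
        ((i : WithTop P) : WithBot (WithTop P))
      rw [entry_ofEntry] at h1
      rw [op_mul, op_mul, mul_smul, mul_smul, map_smul, h1]
      exact Y.mul_mem i i le_rfl _ (entry_mem h (g _) ((i : WithTop P) : WithBot (WithTop P))) b hb
    | zero => rw [op_zero, zero_smul, map_zero]; exact zero_mem _
    | add s t _ _ hs ht => rw [MulOpposite.op_add, add_smul, map_add]; exact add_mem hs ht
    | smul c t _ ht =>
      rw [Algebra.smul_def, Algebra.commutes, op_mul, mul_smul, map_smul]
      exact Y.smul_mem i c _ ht
  have := key 1 (h.one_mem_span i)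
  rwa [op_one, one_smul] at this

end Full

theorem repFunctor_faithful [FiniteDimensional K A] : h.repFunctor.Faithful := by
  refine ⟨fun {X Y f g} hfg => ?_⟩
  obtain ⟨F⟩ := h.nonempty_fullIdempotent
  refine Rep.Hom.ext (LinearMap.ext fun z => ?_)
  have hk : ∀ k, f.hom (op (F.a k) • z) = g.hom (op (F.a k) • z) := fun k => by
    let x := h.ofEntry (X := X) (sink P) (op (F.a k) • z) (mem_repPart_sink _) (by
      change op (ε ⊤) • _ = _
      rw [smul_smul, ← op_mul, F.a_mul])
    have h1 : h.repMap f = h.repMap g := congr_arg (fun t => fullHom t) hfg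
    have h2 := congr_arg (entry (sink P)) (LinearMap.congr_fun h1 x)
    rwa [entry_repMap, entry_repMap, entry_ofEntry] at h2
  rw [← sum_smul_smul F z, map_sum, map_sum]
  exact Finset.sum_congr rfl fun k _ => (map_smul f.hom _ _).trans
    ((congr_arg _ (hk k)).trans (map_smul g.hom _ _).symm)

theorem repFunctor_full [FiniteDimensional K A] : h.repFunctor.Full := by
  refine ⟨fun {X Y} g => ?_⟩
  obtain ⟨F⟩ := h.nonempty_fullIdempotent
  let g' : h.RepMod X →ₗ[h.Algᵐᵒᵖ] h.RepMod Y := fullHom g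
  let f : X ⟶ Y := ⟨h.preimageMap g' F, h.preimageMap_mem g' F⟩
  have hf : h.repMap f = g' :=
    LinearMap.ext fun x => RepMod.ext h fun i => h.preimageMap_entry g' F x i
  exact ⟨f, ObjectProperty.hom_ext _ (ModuleCat.hom_ext hf)⟩

end RepModule

end MultSystem.IsExtendable

/-! ### Every module of `CatU` comes from a representation. -/

namespace MultSystem.IsExtendable

open IncAlg MulOpposite

variable {K A P : Type u} [Field K] [Ring A] [Algebra K A] [PartialOrder P] [Fintype P]
  {T : MultSystem K A P} {ε : WithTop P → A} (h : T.IsExtendable ε)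

section EssSurj

variable {ν : Type u}

/-- The `j`-th entry of an element of `e_0 Λ`. -/
def coordE₀ (j : WithBot (WithTop P)) : h.E₀ →+ rightIdeal (ε ⊤) where
  toFun y := ⟨(y : h.Alg).val ⊥ j, (rightIdeal_mem h.idem_top).2
    (h.mem_space_bot.1 ((y : h.Alg).val_mem ⊥ j)).1⟩
  map_zero' := rfl
  map_add' _ _ := rfl

theorem coordE₀_smul (c : h.Algᵐᵒᵖ) (y : h.E₀) (j : WithBot (WithTop P)) :
    h.coordE₀ j (c • y) = ∑ i, op ((unop c).val i j) • h.coordE₀ i y := by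
  refine Subtype.ext ?_
  rw [AddSubmonoidClass.coe_finsetSum]
  rfl

/-- The `j`-th entries of an element of `(e_0 Λ)^(ν)`. -/
noncomputable def coord (ν : Type u) (j : WithBot (WithTop P)) :
    (ν →₀ h.E₀) →+ (ν →₀ rightIdeal (ε ⊤)) :=
  Finsupp.mapRange.addMonoidHom (h.coordE₀ j)

theorem coord_smul (c : h.Algᵐᵒᵖ) (y : ν →₀ h.E₀) (j : WithBot (WithTop P)) :
    h.coord ν j (c • y) = ∑ i, op ((unop c).val i j) • h.coord ν i y := by
  ext1 k
  rw [Finsupp.finsetSum_apply]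
  exact h.coordE₀_smul c (y k) j

theorem coord_ext {x y : ν →₀ h.E₀} (hxy : ∀ j, h.coord ν j x = h.coord ν j y) : x = y :=
  Finsupp.ext fun k => h.ext_E₀ fun i => congr_arg Subtype.val (DFunLike.congr_fun (hxy i) k)

theorem coord_single_smul {i j : WithBot (WithTop P)} (r : h.system.space i j) (y : ν →₀ h.E₀) :
    h.coord ν j (op (single h.system i j r) • y) = op (r : A) • h.coord ν i y := by
  classical
  rw [coord_smul, Finset.sum_eq_single i]
  · rw [unop_op, val_single_same]
  · intro k _ hk
    rw [unop_op, val_single, if_neg fun h => hk h.1, op_zero, zero_smul]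
  · simp

theorem coord_single_smul_of_ne {i j l : WithBot (WithTop P)} (hl : l ≠ j)
    (r : h.system.space i j) (y : ν →₀ h.E₀) :
    h.coord ν l (op (single h.system i j r) • y) = 0 := by
  classical
  rw [coord_smul]
  refine Finset.sum_eq_zero fun k _ => ?_
  rw [unop_op, val_single, if_neg fun h => hl h.2, op_zero, zero_smul]

theorem smul_coord (j : WithBot (WithTop P)) (y : ν →₀ h.E₀) :
    op (botIdem ε j) • h.coord ν j y = h.coord ν j y :=
  Finsupp.ext fun k => Subtype.ext (h.mem_space_bot.1 ((y k : h.Alg).val_mem ⊥ j)).2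

theorem exists_coord_sink_eq (z : ν →₀ rightIdeal (ε ⊤)) :
    ∃ y : ν →₀ h.E₀, h.coord ν (sink P) y = op (ε ⊤) • z := by
  let t : rightIdeal (ε ⊤) →+ h.E₀ :=
    { toFun := fun z => ⟨single h.system ⊥ (sink P) ⟨z * ε ⊤, h.mem_space_sink.2
        ⟨by
          change ε ⊤ * _ = _
          rw [← mul_assoc, (rightIdeal_mem h.idem_top).1 z.2], by rw [mul_assoc, h.idem_top]⟩⟩,
        h.single_bot_mem _⟩
      map_zero' := Subtype.ext (by
        change single h.system ⊥ (sink P) _ = 0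
        rw [← map_zero (single h.system ⊥ (sink P))]
        exact congr_arg _ (Subtype.ext (zero_mul _)))
      map_add' := fun x y => Subtype.ext (by
        change single h.system ⊥ (sink P) _ =
          single h.system ⊥ (sink P) _ + single h.system ⊥ (sink P) _
        rw [← map_add]
        exact congr_arg _ (Subtype.ext (add_mul _ _ _))) }
  refine ⟨Finsupp.mapRange.addMonoidHom t z, Finsupp.ext fun k => Subtype.ext ?_⟩
  exact val_single_same _

/-- The set of `j`-th entries of the elements of a submodule of `(e_0 Λ)^(ν)`. -/
noncomputable def coordImage (N : Submodule h.Algᵐᵒᵖ (ν →₀ h.E₀)) (j : WithBot (WithTop P)) :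
    AddSubgroup (ν →₀ rightIdeal (ε ⊤)) where
  carrier := {z | ∃ y ∈ N, h.coord ν j y = z}
  add_mem' := by
    rintro _ _ ⟨x, hx, rfl⟩ ⟨y, hy, rfl⟩
    exact ⟨x + y, N.add_mem hx hy, map_add _ _ _⟩
  zero_mem' := ⟨0, N.zero_mem, map_zero _⟩
  neg_mem' := by
    rintro _ ⟨x, hx, rfl⟩
    exact ⟨(-1 : h.Algᵐᵒᵖ) • x, N.smul_mem _ hx, Finsupp.ext fun k =>
      (congr_arg (h.coordE₀ j) (neg_one_smul _ (x k))).trans ((h.coordE₀ j).map_neg (x k))⟩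

/-- The subgroups of the representation of a submodule of `(e_0 Λ)^(ν)`. -/
noncomputable def coordSub (N : Submodule h.Algᵐᵒᵖ (ν →₀ h.E₀)) (i : P) :
    AddSubgroup (ν →₀ rightIdeal (ε ⊤)) where
  -- A conductor: these are the largest subgroups, stable under `T`, whose `ε_j`-parts consist of
  -- entries of `N`.
  carrier := {z | ∀ j : P, ∀ t ∈ T.space i j, op (t * ε j) • z ∈
    h.coordImage N ((j : WithTop P) : WithBot (WithTop P))}
  add_mem' hx hy j t ht := by
    rw [smul_add]
    exact add_mem (hx j t ht) (hy j t ht)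
  zero_mem' j t _ := by
    rw [smul_zero]
    exact zero_mem _
  neg_mem' hx j t ht := by
    rw [smul_neg]
    exact neg_mem (hx j t ht)

theorem mem_coordSub {N : Submodule h.Algᵐᵒᵖ (ν →₀ h.E₀)} {i : P} {z : ν →₀ rightIdeal (ε ⊤)} :
    z ∈ h.coordSub N i ↔ ∀ j : P, ∀ t ∈ T.space i j, ∃ y ∈ N,
      h.coord ν ((j : WithTop P) : WithBot (WithTop P)) y = op (t * ε j) • z := Iff.rfl

/-- The representation of a submodule of `(e_0 Λ)^(ν)`. -/
noncomputable abbrev repOfSubmodule (N : Submodule h.Algᵐᵒᵖ (ν →₀ h.E₀)) : T.Rep where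
  L := ν →₀ rightIdeal (ε ⊤)
  sub := h.coordSub N
  smul_mem i c x hx := h.mem_coordSub.2 fun j t ht => by
    rw [smul_smul, ← op_mul, ← mul_assoc, ← Algebra.smul_def]
    exact h.mem_coordSub.1 hx j _ (Submodule.smul_mem _ c ht)
  mul_mem i j _ x hx r hr := h.mem_coordSub.2 fun l t ht => by
    rw [smul_smul, ← op_mul, ← mul_assoc]
    exact h.mem_coordSub.1 hx l _ (T.mul_mem' i j l hr ht)
  mul_one i x _ := by rw [h.unital.one_eq, op_one, one_smul]

variable {N : Submodule h.Algᵐᵒᵖ (ν →₀ h.E₀)} (hN : ∀ y ∈ N, op (idem h.system ⊥) • y = 0)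

include hN in
theorem coord_mem_repPart {y : ν →₀ h.E₀} (hy : y ∈ N) (i : WithBot (WithTop P)) :
    h.coord ν i y ∈ repPart (h.repOfSubmodule N) i := by
  induction i using WithBot.recBotCoe with
  | bot =>
    have h1 := h.coord_single_smul ⟨_, h.system.one_mem ⊥⟩ y
    rw [← idem_eq_single, hN y hy, map_zero] at h1
    exact AddSubgroup.mem_bot.2 ((h.smul_coord ⊥ y).symm.trans h1.symm)
  | coe i =>
    induction i using WithTop.recTopCoe with
    | top => trivial
    | coe i =>
      refine h.mem_coordSub.2 fun j t ht => ?_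
      have hr : ε i * (t * ε j) ∈ h.system.space ((i : WithTop P) : WithBot (WithTop P))
          ((j : WithTop P) : WithBot (WithTop P)) := ⟨t, ht, rfl⟩
      refine ⟨op (single h.system _ _ ⟨_, hr⟩) • y, N.smul_mem _ hy, ?_⟩
      rw [coord_single_smul]
      conv_rhs => rw [← h.smul_coord, smul_smul, ← op_mul]
      rfl

/-- A submodule of `(e_0 Λ)^(ν)` maps to the module of its representation. -/
noncomputable def toRepMod : N →ₗ[h.Algᵐᵒᵖ] h.RepMod (h.repOfSubmodule N) where
  toFun y := ⟨fun i => h.coord ν i y, fun i => ⟨h.coord_mem_repPart hN y.2 i, h.smul_coord i _⟩⟩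
  map_add' x y := RepMod.ext h fun i => (h.coord ν i).map_add x y
  map_smul' c y := RepMod.ext h fun j => h.coord_smul c y.1 j

/-- `hs` provides every entry at `𝔪`, and at the other points the conductor condition gives back
entries of `N`. Entries coming from different elements of `N` are assembled with the idempotents of
`Λ`. -/
theorem toRepMod_bijective (hs : ∀ y : ν →₀ h.E₀, op (idem h.system (sink P)) • y ∈ N) :
    Function.Bijective (h.toRepMod hN) := by
  refine ⟨fun x y hxy => Subtype.ext (h.coord_ext fun j => ?_), fun x => ?_⟩
  · exact congr_arg (RepMod.entry j) hxy
  · have : ∀ i, ∃ m ∈ N, h.coord ν i m = RepMod.entry i x := fun i => by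
      have hx := RepMod.entry_mem h x i
      have hx' := RepMod.smul_entry h x i
      induction i using WithBot.recBotCoe with
      | bot => exact ⟨0, N.zero_mem, (map_zero _).trans (AddSubgroup.mem_bot.1 hx).symm⟩
      | coe i =>
        induction i using WithTop.recTopCoe with
        | top =>
          obtain ⟨y, hy⟩ := h.exists_coord_sink_eq (RepMod.entry (sink P) x)
          refine ⟨_, hs y, ?_⟩
          rw [idem_eq_single, coord_single_smul, hy]
          exact (congr_arg _ hx').trans hx'
        | coe i =>
          -- With `j = i` and `t = 1` the conductor condition says that `z ε_i` is an entry of `N`.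
          have h1 := h.mem_coordSub.1 hx i 1 (h.unital i)
          rw [_root_.one_mul] at h1
          obtain ⟨m, hm, hm'⟩ := h1
          exact ⟨m, hm, hm'.trans hx'⟩
    choose m hm hm' using this
    refine ⟨⟨∑ i, op (idem h.system i) • m i, sum_mem fun i _ => N.smul_mem _ (hm i)⟩,
      RepMod.ext h fun j => ?_⟩
    change h.coord ν j (∑ i, op (idem h.system i) • m i) = _
    rw [map_sum, Finset.sum_eq_single j, idem_eq_single, coord_single_smul, hm']
    · exact RepMod.smul_entry h x j
    · intro i _ hi
      rw [idem_eq_single, h.coord_single_smul_of_ne hi.symm]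
    · simp

theorem repFunctor_essSurj [FiniteDimensional K A] : h.repFunctor.EssSurj := by
  refine ⟨fun M => ?_⟩
  have H := h.socleFrame
  obtain ⟨hM1, hM2⟩ := H.mem_U_iff.1 M.property
  obtain ⟨E⟩ := H.exists_sumEnvelope hM1
  have hN : ∀ y ∈ LinearMap.range E.map, op (idem h.system ⊥) • y = 0 := by
    rintro _ ⟨x, rfl⟩
    rw [← map_smul]
    exact (congr_arg E.map (hM2 x)).trans (map_zero _)
  let α := (LinearEquiv.ofInjective E.map E.map_injective).trans
    (LinearEquiv.ofBijective _ (h.toRepMod_bijective hN (H.sink_smul_mem_range E)))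
  exact ⟨_, ⟨ObjectProperty.isoMk _ α.symm.toModuleIso⟩⟩

end EssSurj

end MultSystem.IsExtendable

theorem mainTheorem5 {K A P : Type u} [Field K] [Ring A] [Algebra K A] [FiniteDimensional K A]
    [PartialOrder P] [Fintype P] (T : MultSystem K A P) (ε : WithTop P → A)
    (h : T.IsExtendable ε) :
    (∀ M : CatU h.Algᵐᵒᵖ h.E₀, Nonempty (SumEnvelope h.Algᵐᵒᵖ M.obj h.E₀)) ∧
    (∀ env : (∀ M : CatU h.Algᵐᵒᵖ h.E₀, SumEnvelope h.Algᵐᵒᵖ M.obj h.E₀),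
      ∃ F : CatU h.Algᵐᵒᵖ h.E₀ ⥤ CatV h.Algᵐᵒᵖ h.E₀,
        IsCokernelFunctor env F ∧ F.IsEquivalence ∧ IsExactFunctor F) ∧
    Nonempty (T.Rep ≌ CatU h.Algᵐᵒᵖ h.E₀) := by
  have H := h.socleFrame
  have : h.repFunctor.IsEquivalence :=
    { faithful := h.repFunctor_faithful
      full := h.repFunctor_full
      essSurj := h.repFunctor_essSurj }
  exact ⟨fun M => H.exists_sumEnvelope (H.mem_U_iff.1 M.property).1, H.exists_cokernelFunctor,
    ⟨h.repFunctor.asEquivalence⟩⟩
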